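/- Logarithms are to base 2. For every $\kappa>0$ there are constants $c,C>0$, depending only on $\kappa$, such that the following holds. Let $m\ge 2$ be a power of two, $\alpha,\beta\ge 0$ with $\alpha^2+\beta^2=1$ and $\beta^2\le\kappa/m$, let $\varepsilon,\varepsilon'\in(0,1/2)$, and let the Hamming-weight cutoffs $k,k'\in\mathbb N$ satisfy $$k\ge c\,\frac{\log(1/\varepsilon)}{\log\log(1/\varepsilon)},\qquad k'\ge c\,\frac{\log(1/\varepsilon')}{\log\log(1/\varepsilon')}.$$ *Uncompressed scheme.* Let $R=\begin{pmatrix}\alpha&\beta\\ \beta&-\alpha\end{pmatrix}$. The $m$ control qubits and the target are in the state $\sum_{x\in\{0,1\}^m} i^{|x|}\alpha^{m-|x|}\beta^{|x|}|x\rangle|w_x\rangle$ with unit vectors $w_x$ in a finite-dimensional target space; $R^{\otimes m}$ is applied to the control qubits, which are then measured in the computational basis. Let $p_b\rho_b$ be the outcome-weighted (unnormalised) target state for the outcome $b\in\{0,1\}^m$. *Compressed scheme.* For $n\le m$ and $x=0^{s_1}1\cdots 0^{s_h}10^t\in\{0,1\}^n$ with $h=|x|\le k+1$ let $C^k_n|x\rangle=|s_1,\dots,s_h,n,\dots,n\rangle\in(\mathbb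 C^{m+1})^{\otimes(k+1)}$. Let $a^n_x=\alpha^{n-|x|}\beta^{|x|}$ for $|x|\le k$ and $a^n_x=\alpha^{s_1+\cdots+s_{k+1}}\beta^{k+1}$ for $|x|=k+1$. For each $n\in\{1,2,4,\dots,m\}$ let $\widetilde U_n$ be any unitary on the register and an ancilla (initial state $|0\rangle$) with $$\widetilde U_n\,C^k_n|0^n\rangle\otimes|0\rangle=\sum_{|x|\le k+1}a^n_x\left[\sqrt{1-\varepsilon_x}\,C^k_n|x\rangle\otimes|0\rangle+\sqrt{\varepsilon_x}\,|\mathrm{err}_x\rangle\right],$$ where $0\le\varepsilon_x\le\varepsilon$ and the $\mathrm{err}_x$ are unit vectors whose ancilla part is orthogonal to $|0\rangle$ ($\varepsilon_x$ and $\mathrm{err}_x$ may depend on $n$). The register is prepared by $\widetilde U_m$ from $C^k_m|0^m\rangle$; each basis state of the register gets the phase $i^{h}$, where $h$ is the number of its entries different from $m$; and, controlled by the register, the target is brought to a unit vector that equals $w_x$ on $C^k_m|x\rangle$ whenever $|x|\le\min(k,k')$. Then the register is measured recursively. On a register that encodes a block of $n$ control qubits, append a fresh ancilla in $|0\rangle$,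 apply $\widetilde U_n^\dagger$, make the two-outcome measurement of the projection onto $C^k_n|0^n\rangle\otimes|0\rangle$ against its complement, apply $\widetilde U_n$, and discard the ancilla. On the first outcome the block is reported as all zeros. On the second outcome, if $n=1$ a one is reported, and if $n>1$ the register is split by any isometry with $C^k_n|x_1x_2\rangle\mapsto C^k_{n/2}|x_1\rangle\otimes C^k_{n/2}|x_2\rangle$ for $|x_1x_2|\le k$, and the two halves are measured one after the other in the same way. The procedure stops once a prescribed number $\ell\ge k'$ of ones has been located, and then reports zeros in all the remaining positions ($\ell=k'$ is the truncated scheme, $\ell=m$ is no truncation). Let $\tilde p_b\tilde\rho_b$ be the outcome-weighted target state for the reported string $b$. Then $$D_{\rm av}:=\sum_{b\in\{0,1\}^m}\left\|p_b\rho_b-\tilde p_b\tilde\rho_b\right\|_{\rm tr}\ \le\ C\,(\varepsilon'+\varepsilon\,k'\log m).$$ -/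

import Mathlib

open scoped Matrix Kronecker

noncomputable section

namespace CompressedMeasurement

universe u

/-! ## Bit strings and their succinct encoding -/

/-- Bit strings of length `n`. -/
abbrev Bits (n : ℕ) := Fin n → Bool

/-- The all-zero string. -/
def zeroBits (n : ℕ) : Bits n := fun _ => false

/-- Hamming weight. -/
def wt {n : ℕ} (x : Bits n) : ℕ := (Finset.univ.filter fun i => x i = true).card

/-- First half of a string of length `2 ^ (q + 1)`. -/
def firstHalf {q : ℕ} (x : Bits (2 ^ (q + 1))) : Bits (2 ^ q) :=
  fun i => x ⟨i.1, by have := i.2; rw [pow_succ]; omega⟩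

/-- Second half of a string of length `2 ^ (q + 1)`. -/
def secondHalf {q : ℕ} (x : Bits (2 ^ (q + 1))) : Bits (2 ^ q) :=
  fun i => x ⟨2 ^ q + i.1, by have := i.2; rw [pow_succ]; omega⟩

/-- `gaps 0 (0^{s₁} 1 0^{s₂} 1 … 0^{s_h} 1 0^t) = [s₁, …, s_h]`; the first argument counts the
zeros seen since the last one. -/
def gaps : ℕ → List Bool → List ℕ
  | _, [] => []
  | c, false :: l => gaps (c + 1) l
  | c, true :: l => c :: gaps 0 l

/-- Computational basis of the control register `(ℂ^{m+1})^{⊗ (k+1)}`. -/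
abbrev Reg (k m : ℕ) := Fin (k + 1) → Fin (m + 1)

/-- The basis state `C_n^k |x⟩ = |s₁, …, s_h, n, …, n⟩` of the register, for `x ∈ {0,1}^n` and
`n ≤ m`; only the first `k + 1` ones are recorded. -/
def enc (k m : ℕ) {n : ℕ} (x : Bits n) : Reg k m :=
  fun i => Fin.ofNat (m + 1) ((gaps 0 (List.ofFn x)).getD i.1 n)

/-- Amplitude of `C_n^k |x⟩` in the ideal compressed control state: it is `α^{n-|x|} β^{|x|}` for
`|x| ≤ k`, and `α^{s₁+⋯+s_{k+1}} β^{k+1}` for `|x| = k + 1` (the component in which the register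
has run out of space and only the first `k + 1` ones of the string are determined). -/
def amp (α β : ℝ) (k : ℕ) {n : ℕ} (x : Bits n) : ℝ :=
  if wt x ≤ k then α ^ (n - wt x) * β ^ wt x
  else α ^ (gaps 0 (List.ofFn x)).sum * β ^ wt x

/-! ## Operators -/

section Operators

variable {ι κ E : Type*} [Fintype ι] [Fintype κ] [Fintype E] [DecidableEq E]

/-- Trace norm: the sum of the singular values. -/
def traceNorm [DecidableEq ι] (M : Matrix ι ι ℂ) : ℝ :=
  ∑ i, Real.sqrt ((Matrix.isHermitian_conjTranspose_mul_self M).eigenvalues i)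

/-- `|ψ⟩⟨ψ|`. -/
def pureState (ψ : ι → ℂ) : Matrix ι ι ℂ := Matrix.vecMulVec ψ (star ψ)

/-- Partial trace over the first tensor factor. -/
def traceLeft (ρ : Matrix (ι × E) (ι × E) ℂ) : Matrix E E ℂ :=
  fun e e' => ∑ i, ρ (i, e) (i, e')

/-- `ρ ↦ (K ⊗ I) ρ (K ⊗ I)†`. -/
def applyLeft (K : Matrix κ ι ℂ) (ρ : Matrix (ι × E) (ι × E) ℂ) : Matrix (κ × E) (κ × E) ℂ :=
  (K ⊗ₖ (1 : Matrix E E ℂ)) * ρ * (K ⊗ₖ (1 : Matrix E E ℂ))ᴴ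

end Operators

/-! ## The uncompressed scheme -/

/-- The one-qubit gate `R = [[α, β], [β, -α]]`. -/
def gateR (α β : ℝ) : Matrix Bool Bool ℂ
  | false, false => α
  | false, true => β
  | true, false => β
  | true, true => -α

/-- `R^{⊗ n}`. -/
def gateRPow (α β : ℝ) (n : ℕ) : Matrix (Bits n) (Bits n) ℂ :=
  fun y x => ∏ i, gateR α β (y i) (x i)

/-- State of the `m` control qubits and the target before the final measurement:
`∑ₓ i^{|x|} ⟨x|R^{⊗m}|0^m⟩ |x⟩ |wₓ⟩`, i.e. `R^{⊗m}` and `P^{⊗m}` (`P = diag(1, i)`) are applied to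
`|0^m⟩`, and then the target is brought to the state `wₓ`, controlled by `x`. -/
def uncState {m : ℕ} {τ : Type*} (α β : ℝ) (w : Bits m → τ → ℂ) : Bits m × τ → ℂ :=
  fun z => Complex.I ^ wt z.1 * gateRPow α β m z.1 (zeroBits m) * w z.1 z.2

/-- Outcome-weighted target state `p_b ρ_b` of the uncompressed scheme: apply `R^{⊗m}` to the
control qubits and measure them in the computational basis; the measurement operator is
`|b⟩⟨b| R^{⊗m}`. -/
def uncOutcome {m : ℕ} {τ : Type*} [Fintype τ] [DecidableEq τ] (α β : ℝ) (w : Bits m → τ → ℂ)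
    (b : Bits m) : Matrix τ τ ℂ :=
  traceLeft (applyLeft (Matrix.single b b (1 : ℂ) * gateRPow α β m) (pureState (uncState α β w)))

/-! ## The compressed scheme -/

section Compressed

variable {k m : ℕ} {A : Type*} [Fintype A] [DecidableEq A]

/-- `U` is an implementation with error flag and accuracy `ε` of the ideal preparation `U_n` of the
compressed control state of length `n`.  It is a unitary on the register and an ancilla (initial
state `a₀`) with
`U (C_n^k |0^n⟩ ⊗ |a₀⟩) = ∑_{|x| ≤ k+1} aₓ [√(1-eₓ) C_n^k |x⟩ ⊗ |a₀⟩ + √eₓ |errₓ⟩]`,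
where `0 ≤ eₓ ≤ ε` and the unit vectors `errₓ` are supported where the ancilla is orthogonal
to `a₀`. -/
def IsFlaggedPrep (α β ε : ℝ) (a₀ : A) (n : ℕ)
    (U : Matrix (Reg k m × A) (Reg k m × A) ℂ) : Prop :=
  U ∈ Matrix.unitaryGroup (Reg k m × A) ℂ ∧
  ∃ (e : Bits n → ℝ) (err : Bits n → Reg k m × A → ℂ),
    (∀ x, 0 ≤ e x ∧ e x ≤ ε) ∧
    (∀ x s, err x (s, a₀) = 0) ∧
    (∀ x, ∑ z, ‖err x z‖ ^ 2 = 1) ∧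
    ∀ z, U z (enc k m (zeroBits n), a₀) =
      ∑ x : Bits n with wt x ≤ k + 1, (amp α β k x : ℂ) *
        ((Real.sqrt (1 - e x) : ℂ) * (if z = (enc k m x, a₀) then 1 else 0)
          + (Real.sqrt (e x) : ℂ) * err x z)

/-- `S` splits an encoded string of length `2 ^ (q + 1)` into its encoded halves: it is an isometry
(a unitary that is supplied with one fresh register) such that
`S C |x₁x₂⟩ = C |x₁⟩ ⊗ C |x₂⟩` whenever `|x₁x₂| ≤ k`. -/
def IsSplit (q : ℕ) (S : Matrix (Reg k m × Reg k m) (Reg k m) ℂ) : Prop :=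
  Sᴴ * S = 1 ∧
  ∀ (x : Bits (2 ^ (q + 1))), wt x ≤ k → ∀ z,
    S z (enc k m x) = if z = (enc k m (firstHalf x), enc k m (secondHalf x)) then 1 else 0

/-- The operators of the two-outcome measurement implemented with `U`: outcome `0` (`false`) is the
projection `U (C_n^k |0^n⟩⟨0^n| (C_n^k)† ⊗ |a₀⟩⟨a₀|) U†`, outcome `1` (`true`) its complement. -/
def measProj (a₀ : A) (n : ℕ) (U : Matrix (Reg k m × A) (Reg k m × A) ℂ) :
    Bool → Matrix (Reg k m × A) (Reg k m × A) ℂ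
  | false => U * Matrix.single (enc k m (zeroBits n), a₀) (enc k m (zeroBits n), a₀) 1 * Uᴴ
  | true => 1 - U * Matrix.single (enc k m (zeroBits n), a₀) (enc k m (zeroBits n), a₀) 1 * Uᴴ

/-- Unnormalised state after outcome `d` of that measurement: fresh ancillas are appended in the
state `a₀`, the measurement is made, and the ancillas are traced out.  (The Kraus operators are
`⟨a| Π_d |a₀⟩`, where `a` runs through the ancilla basis.) -/
def measStep (a₀ : A) (n : ℕ) (U : Matrix (Reg k m × A) (Reg k m × A) ℂ)
    {E : Type u} [Fintype E] [DecidableEq E] (d : Bool)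
    (ρ : Matrix (Reg k m × E) (Reg k m × E) ℂ) : Matrix (Reg k m × E) (Reg k m × E) ℂ :=
  ∑ a : A, applyLeft (fun s s' => measProj a₀ n U d (s, a) (s', a₀)) ρ

/-- The recursive measurement.  `measure a₀ U S q limit ρ b` is the unnormalised state of the
environment (all that is not in the measured register) when the procedure, run on a register that
encodes `2 ^ q` control qubits, returns the positions of the ones of `b`.  The measured register is
traced out at the end.  The procedure stops as soon as `limit` ones have been located, and then
reports no further ones. -/
def measure (a₀ : A) (U : ℕ → Matrix (Reg k m × A) (Reg k m × A) ℂ)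
    (S : ℕ → Matrix (Reg k m × Reg k m) (Reg k m) ℂ) :
    (q : ℕ) → (limit : ℕ) → {E : Type u} → [Fintype E] → [DecidableEq E] →
      Matrix (Reg k m × E) (Reg k m × E) ℂ → Bits (2 ^ q) → Matrix E E ℂ
  | 0, limit, _, _, _, ρ, b =>
      if limit = 0 then (if b = zeroBits _ then traceLeft ρ else 0)
      else traceLeft (measStep a₀ 1 (U 0) (b 0) ρ)
  | q + 1, limit, _, _, _, ρ, b =>
      if limit = 0 then (if b = zeroBits _ then traceLeft ρ else 0)
      else
        -- outcome 0: no ones in this block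
        (if b = zeroBits _ then traceLeft (measStep a₀ (2 ^ (q + 1)) (U (q + 1)) false ρ) else 0)
        -- outcome 1: split the register, measure the first half, then the second half
        + measure a₀ U S q (limit - wt (firstHalf b))
            (measure a₀ U S q limit
              (Matrix.reindex (Equiv.prodAssoc _ _ _) (Equiv.prodAssoc _ _ _)
                (applyLeft (S q) (measStep a₀ (2 ^ (q + 1)) (U (q + 1)) true ρ)))
              (firstHalf b))
            (secondHalf b)

/-- State of the register and the target before the final measurement, for `m = 2 ^ p`: the
register is prepared by `U p`, the phase `i^{|x|}` is applied (`|x|` is the number of entries of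
the register that differ from `m`), the target is brought to the state `w s`, controlled by the
register, and the ancillas are traced out. -/
def comState (a₀ : A) (U : Matrix (Reg k m × A) (Reg k m × A) ℂ)
    {τ : Type u} [Fintype τ] (w : Reg k m → τ → ℂ) :
    Matrix (Reg k m × τ) (Reg k m × τ) ℂ :=
  ∑ a : A, pureState fun z =>
    U (z.1, a) (enc k m (zeroBits m), a₀) *
      Complex.I ^ (Finset.univ.filter fun i => z.1 i ≠ Fin.last m).card * w z.1 z.2

end Compressed

/-- Outcome-weighted target state `p_b ρ_b` of the compressed scheme with `m = 2 ^ p`. -/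
def comOutcome {k p : ℕ} {A : Type*} [Fintype A] [DecidableEq A] {τ : Type u} [Fintype τ]
    [DecidableEq τ] (a₀ : A) (U : ℕ → Matrix (Reg k (2 ^ p) × A) (Reg k (2 ^ p) × A) ℂ)
    (S : ℕ → Matrix (Reg k (2 ^ p) × Reg k (2 ^ p)) (Reg k (2 ^ p)) ℂ) (limit : ℕ)
    (w : Reg k (2 ^ p) → τ → ℂ) (b : Bits (2 ^ p)) : Matrix τ τ ℂ :=
  measure a₀ U S p limit (comState a₀ (U p) w) b

/-- `D_av`: the sum over all measurement results of the trace norm of the difference of the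
outcome-weighted target states. -/
def Dav {m : ℕ} {τ : Type*} [Fintype τ] [DecidableEq τ] (σ σ' : Bits m → Matrix τ τ ℂ) : ℝ :=
  ∑ b, traceNorm (σ b - σ' b)

/-- The order of growth `log(1/δ) / log log(1/δ)` (base 2) of the Hamming weight cutoffs. -/
def cutoff (δ : ℝ) : ℝ := Real.logb 2 (1 / δ) / Real.logb 2 (Real.logb 2 (1 / δ))

end CompressedMeasurement

end

open CompressedMeasurement

/-!
Run the recursive measurement and keep only the branch in which no error flag is raised, every block
with a nonzero outcome turns out to contain a one, and a register that encodes a single one is found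
along one fixed vector when it is discarded. In this branch each outcome `b` has a single Kraus
operator, and it has rank one on the register: a row vector `g_b` that satisfies
`g_b = (g_{b₁} ⊗ g_{b₂}) S (I - |φ̃⟩⟨φ̃|)` for `b = b₁b₂ ≠ 0` and `g_0 = ⟨φ̃|`, where `φ̃` is the
flag-free part of the prepared state (`treeRow`, `registerRow`). All other branches are positive, so
that the outcome-weighted target state dominates the pure state of `g_b`
(`posSemidef_measure_sub_applyRow`), and since total probability is one their contribution to the
trace distance is controlled by the distance of the pure states (`sum_traceNorm_sub_le`). This turns
the claim into an `ℓ²` estimate for vectors, in which the errors are of order `ε`: the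
flagged components, of amplitude `√ε`, do not occur in the branch, and the flag-free ones are off by
`1 - √(1 - e) ≤ ε`.

The rows of `R^{⊗ m}` satisfy the same recursion with the ideal state `φ` (`treeRow_bits`). Both
recursions are compared with a third one, on the strings with at most `k` ones and with `φ` cut off
there. It is embedded exactly in the register by the encoding, and in both cases the preparation
vectors agree up to `O(ε)`, because the binomial tail beyond `k` is at most `ε²`
(`sum_pow_wt_tail_le`). The accumulated error is bounded by `sum_treeErr_sq_le`: an outcome with
`h` ones in a block of length `2 ^ q` is reached after at most `1 + 2 q h` measurements. By the
Cauchy-Schwarz inequality along the path, the squared error of an outcome, divided by this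
number, is at most the sum of the squared errors of the measurements on its path, and the sum of
the latter over all outcomes is `O(ε²)` times an expected number of measurements, which the
potential `treePot` bounds by `1 + 2 q (h + 1)` when at most `h` ones are sought.

Outcomes with `k'` or more ones are rare in the uncompressed scheme, because a one costs a factor
`2 α β` in amplitude whatever the target states are (`nsq_contract_uncState_le`); they are therefore
rare in the compressed scheme as well, and the limit on the number of located ones, which affects
only these outcomes, does not matter.
-/

noncomputable section

namespace CompressedMeasurement

set_option linter.unusedSectionVars false

universe u

/-! ### Vectors and row vectors -/

/-- The squared `ℓ²` norm of a finite vector. -/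
def nsq {ι : Type*} [Fintype ι] (x : ι → ℂ) : ℝ := ∑ i, ‖x i‖ ^ 2

section Vectors

variable {ι κ : Type*} [Fintype ι] [Fintype κ]

lemma nsq_nonneg (x : ι → ℂ) : 0 ≤ nsq x := Finset.sum_nonneg fun _ _ => by positivity

lemma nsq_eq_norm_sq (x : ι → ℂ) : nsq x = ‖WithLp.toLp 2 x‖ ^ 2 := by
  simp [nsq, EuclideanSpace.norm_sq_eq]

lemma ofReal_nsq (x : ι → ℂ) : ((nsq x : ℝ) : ℂ) = star x ⬝ᵥ x := by
  simp [nsq, dotProduct, Complex.conj_mul']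

lemma norm_dotProduct_sq_le (f x : ι → ℂ) : ‖f ⬝ᵥ x‖ ^ 2 ≤ nsq f * nsq x := by
  have h1 : ‖f ⬝ᵥ x‖ ≤ ∑ i, ‖f i‖ * ‖x i‖ := by
    refine (norm_sum_le _ _).trans (le_of_eq ?_)
    simp
  calc ‖f ⬝ᵥ x‖ ^ 2 ≤ (∑ i, ‖f i‖ * ‖x i‖) ^ 2 := by gcongr
    _ ≤ _ := Finset.sum_mul_sq_le_sq_mul_sq _ _ _

lemma nsq_star (x : ι → ℂ) : nsq (star x) = nsq x := by simp [nsq]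

lemma nsq_smul (c : ℂ) (x : ι → ℂ) : nsq (c • x) = ‖c‖ ^ 2 * nsq x := by
  simp [nsq, mul_pow, Finset.mul_sum]

lemma nsq_add_le (x y : ι → ℂ) : nsq (x + y) ≤ 2 * nsq x + 2 * nsq y := by
  simp only [nsq, Finset.mul_sum, ← Finset.sum_add_distrib]
  refine Finset.sum_le_sum fun i _ => ?_
  have := norm_add_le (x i) (y i)
  have h0 := norm_nonneg (x i + y i)
  simp only [Pi.add_apply]
  nlinarith [sq_nonneg (‖x i‖ - ‖y i‖)]

lemma nsq_mulVec_of_isometry [DecidableEq κ] {S : Matrix ι κ ℂ} (hS : Sᴴ * S = 1) (x : κ → ℂ) :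
    nsq (S *ᵥ x) = nsq x := by
  have : ((nsq (S *ᵥ x) : ℝ) : ℂ) = nsq x := by
    rw [ofReal_nsq, ofReal_nsq, Matrix.star_mulVec, ← Matrix.dotProduct_mulVec,
      Matrix.mulVec_mulVec, hS, Matrix.one_mulVec]
  exact_mod_cast this

/-- `I - |φ⟩⟨φ|`. -/
def coproj [DecidableEq ι] (φ : ι → ℂ) : Matrix ι ι ℂ := 1 - Matrix.vecMulVec φ (star φ)

lemma coproj_mulVec [DecidableEq ι] (φ x : ι → ℂ) :
    coproj φ *ᵥ x = x - (star φ ⬝ᵥ x) • φ := by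
  ext i
  simp [coproj, Matrix.sub_mulVec, Matrix.vecMulVec_mulVec, mul_comm]

lemma nsq_coproj_mulVec_le [DecidableEq ι] {φ : ι → ℂ} (hφ : nsq φ ≤ 1) (x : ι → ℂ) :
    nsq (coproj φ *ᵥ x) ≤ nsq x - ‖star φ ⬝ᵥ x‖ ^ 2 := by
  have key : nsq (coproj φ *ᵥ x) = nsq x - (2 - nsq φ) * ‖star φ ⬝ᵥ x‖ ^ 2 := by
    have h2 : star x ⬝ᵥ φ = star (star φ ⬝ᵥ x) := by
      rw [← Matrix.star_dotProduct_star, star_star]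
    have h3 : ((‖star φ ⬝ᵥ x‖ ^ 2 : ℝ) : ℂ) = star (star φ ⬝ᵥ x) * (star φ ⬝ᵥ x) := by
      rw [Complex.star_def, Complex.conj_mul']; push_cast; rfl
    have : ((nsq (coproj φ *ᵥ x) : ℝ) : ℂ)
        = ((nsq x - (2 - nsq φ) * ‖star φ ⬝ᵥ x‖ ^ 2 : ℝ) : ℂ) := by
      push_cast at h3 ⊢
      rw [h3, ofReal_nsq, ofReal_nsq, ofReal_nsq, coproj_mulVec, star_sub, star_smul]
      simp only [sub_dotProduct, dotProduct_sub, smul_dotProduct, dotProduct_smul, smul_eq_mul, h2]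
      ring
    exact_mod_cast this
  rw [key]
  nlinarith [sq_nonneg ‖star φ ⬝ᵥ x‖]

/-- The row vector `f ⊗ g`. -/
def tensor (f : ι → ℂ) (g : κ → ℂ) : ι × κ → ℂ := fun z => f z.1 * g z.2

/-- The partial contraction `(f ⊗ I) z`. -/
def contract (f : ι → ℂ) (z : ι × κ → ℂ) : κ → ℂ := fun j => f ⬝ᵥ fun i => z (i, j)

lemma tensor_dotProduct (f : ι → ℂ) (g : κ → ℂ) (z : ι × κ → ℂ) :
    tensor f g ⬝ᵥ z = g ⬝ᵥ contract f z := by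
  simp only [dotProduct, tensor, contract, Fintype.sum_prod_type, Finset.mul_sum]
  rw [Finset.sum_comm]
  refine Finset.sum_congr rfl fun _ _ => Finset.sum_congr rfl fun _ _ => by ring

lemma nsq_prod (z : ι × κ → ℂ) : nsq z = ∑ j, nsq fun i => z (i, j) := by
  simp only [nsq, Fintype.sum_prod_type]
  rw [Finset.sum_comm]

lemma contract_kronecker_mulVec {ι' κ' : Type*} [Fintype ι'] [Fintype κ'] (f : ι' → ℂ)
    (V : Matrix ι' ι ℂ) (W : Matrix κ' κ ℂ) (z : ι × κ → ℂ) :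
    contract f ((V ⊗ₖ W) *ᵥ z) = W *ᵥ fun j => f ⬝ᵥ (V *ᵥ fun i => z (i, j)) := by
  ext j
  simp only [contract, dotProduct, Matrix.mulVec, Matrix.kroneckerMap_apply,
    Fintype.sum_prod_type, Finset.mul_sum]
  conv_rhs => rw [Finset.sum_comm]
  refine Finset.sum_congr rfl fun i' _ => ?_
  rw [Finset.sum_comm]
  refine Finset.sum_congr rfl fun j' _ => Finset.sum_congr rfl fun i _ => by ring

end Vectors

/-! ### Halves of bit strings -/

/-- A string of length `2 ^ (q + 1)` is the pair of its halves. -/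
def halves (q : ℕ) : Bits (2 ^ (q + 1)) ≃ Bits (2 ^ q) × Bits (2 ^ q) :=
  ((finCongr (by rw [pow_succ]; ring)).arrowCongr (Equiv.refl Bool)).trans
    (Fin.appendEquiv (2 ^ q) (2 ^ q)).symm

lemma halves_apply {q : ℕ} (x : Bits (2 ^ (q + 1))) :
    halves q x = (firstHalf x, secondHalf x) := by
  ext i
  · simp [halves, Fin.appendEquiv, firstHalf, Equiv.arrowCongr]
    rfl
  · simp only [halves, Fin.appendEquiv, secondHalf, Equiv.arrowCongr, Equiv.trans_apply,
      Equiv.coe_fn_mk, Equiv.coe_fn_symm_mk]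
    simp
    congr 1
    ext
    simp [add_comm]

lemma sum_bits_succ {M : Type*} [AddCommMonoid M] {q : ℕ} (F : Bits (2 ^ (q + 1)) → M)
    (G : Bits (2 ^ q) → Bits (2 ^ q) → M) (h : ∀ b, F b = G (firstHalf b) (secondHalf b)) :
    ∑ b, F b = ∑ b₁, ∑ b₂, G b₁ b₂ := by
  rw [← Fintype.sum_prod_type', ← (halves q).sum_comp]
  simp [h, halves_apply]

lemma prod_halves {M : Type*} [CommMonoid M] {q : ℕ} (F : Fin (2 ^ (q + 1)) → M) :
    ∏ i, F i = (∏ i : Fin (2 ^ q), F ⟨i.1, by have := i.2; rw [pow_succ]; omega⟩)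
      * ∏ i : Fin (2 ^ q), F ⟨2 ^ q + i.1, by have := i.2; rw [pow_succ]; omega⟩ := by
  rw [← (finCongr (show 2 ^ q + 2 ^ q = 2 ^ (q + 1) by rw [pow_succ]; ring)).prod_comp,
    Fin.prod_univ_add]
  rfl

lemma wt_eq_sum {n : ℕ} (x : Bits n) : wt x = ∑ i, if x i = true then 1 else 0 := by
  simp [wt]

lemma wt_halves {q : ℕ} (x : Bits (2 ^ (q + 1))) :
    wt x = wt (firstHalf x) + wt (secondHalf x) := by
  have h := prod_halves (M := Multiplicative ℕ) (q := q)
    fun i => Multiplicative.ofAdd (if x i = true then 1 else 0)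
  simp only [wt_eq_sum]
  exact h

lemma wt_zeroBits (n : ℕ) : wt (zeroBits n) = 0 := by simp [wt, zeroBits]

lemma wt_eq_zero {n : ℕ} {x : Bits n} : wt x = 0 ↔ x = zeroBits n := by
  simp [wt, zeroBits, funext_iff, Finset.filter_eq_empty_iff]

/-! ### Trees of measurements -/

section Trees

variable {Z : ℕ → Type} [∀ q, Fintype (Z q)] [∀ q, DecidableEq (Z q)]

/-- The Kraus row vectors of a recursive measurement. A block in the state `x` is projected onto
`φ q`; on the complementary outcome it is split by `S`, or, if it has length one, contracted with
`θ`. For a nonzero string the row starts with the complementary outcome, so that a path with a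
nonzero outcome whose halves are both reported as zero belongs to no row. -/
def treeRow (φ : ∀ q, Z q → ℂ) (θ : Z 0 → ℂ) (S : ∀ q, Matrix (Z q × Z q) (Z (q + 1)) ℂ) :
    (q : ℕ) → Bits (2 ^ q) → Z q → ℂ
  | 0, b => if b 0 = true then θ ᵥ* coproj (φ 0) else star (φ 0)
  | q + 1, b =>
      if b = zeroBits _ then star (φ (q + 1))
      else tensor (treeRow φ θ S q (firstHalf b)) (treeRow φ θ S q (secondHalf b)) ᵥ*
        (S q * coproj (φ (q + 1)))

lemma sum_bits_one {M : Type*} [AddCommMonoid M] (F : Bits (2 ^ 0) → M) :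
    ∑ b, F b = F (fun _ => false) + F (fun _ => true) := by
  change ∑ b : Fin 1 → Bool, F b = _
  rw [← (Equiv.funUnique (Fin 1) Bool).symm.sum_comp, Fintype.sum_bool, add_comm]
  rfl

lemma treeRow_zero_false (φ : ∀ q, Z q → ℂ) (θ : Z 0 → ℂ)
    (S : ∀ q, Matrix (Z q × Z q) (Z (q + 1)) ℂ) :
    treeRow φ θ S 0 (fun _ => false) = star (φ 0) := by simp [treeRow]

lemma treeRow_zero_true (φ : ∀ q, Z q → ℂ) (θ : Z 0 → ℂ)
    (S : ∀ q, Matrix (Z q × Z q) (Z (q + 1)) ℂ) :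
    treeRow φ θ S 0 (fun _ => true) = θ ᵥ* coproj (φ 0) := by simp [treeRow]

lemma treeRow_zeroBits (φ : ∀ q, Z q → ℂ) (θ : Z 0 → ℂ)
    (S : ∀ q, Matrix (Z q × Z q) (Z (q + 1)) ℂ) (q : ℕ) :
    treeRow φ θ S q (zeroBits _) = star (φ q) := by
  cases q with
  | zero => exact treeRow_zero_false φ θ S
  | succ q => simp [treeRow]

lemma treeRow_succ_dotProduct (φ : ∀ q, Z q → ℂ) (θ : Z 0 → ℂ)
    (S : ∀ q, Matrix (Z q × Z q) (Z (q + 1)) ℂ) {q : ℕ} {b : Bits (2 ^ (q + 1))}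
    (hb : b ≠ zeroBits _) (x : Z (q + 1) → ℂ) :
    treeRow φ θ S (q + 1) b ⬝ᵥ x =
      treeRow φ θ S q (secondHalf b) ⬝ᵥ
        contract (treeRow φ θ S q (firstHalf b)) (S q *ᵥ (coproj (φ (q + 1)) *ᵥ x)) := by
  rw [treeRow, if_neg hb, ← Matrix.dotProduct_mulVec, tensor_dotProduct, Matrix.mulVec_mulVec]

/-- Rows that contract on each factor contract on the product. -/
lemma sum_contract_le {B X Y : Type*} [Fintype B] [Fintype X] [Fintype Y] {F : B → X → ℂ}
    {G : B → Y → ℂ} (hF : ∀ x, ∑ b, ‖F b ⬝ᵥ x‖ ^ 2 ≤ nsq x)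
    (hG : ∀ x, ∑ b, ‖G b ⬝ᵥ x‖ ^ 2 ≤ nsq x) (z : X × Y → ℂ) :
    ∑ b₁, ∑ b₂, ‖G b₂ ⬝ᵥ contract (F b₁) z‖ ^ 2 ≤ nsq z := by
  calc _ ≤ ∑ b₁, nsq (contract (F b₁) z) := Finset.sum_le_sum fun b _ => hG _
    _ = ∑ j, ∑ b₁, ‖F b₁ ⬝ᵥ fun i => z (i, j)‖ ^ 2 := by
        simp only [nsq, contract]; rw [Finset.sum_comm]
    _ ≤ ∑ j, nsq fun i => z (i, j) := Finset.sum_le_sum fun j _ => hF _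
    _ = nsq z := (nsq_prod z).symm

/-- The data of a tree of measurements of depth at most `p`: subnormalised preparation vectors,
a subnormalised leaf vector and isometric splittings. -/
structure IsTree (p : ℕ) (φ : ∀ q, Z q → ℂ) (θ : Z 0 → ℂ)
    (S : ∀ q, Matrix (Z q × Z q) (Z (q + 1)) ℂ) : Prop where
  prep : ∀ q ≤ p, nsq (φ q) ≤ 1
  leaf : nsq θ ≤ 1
  split : ∀ q < p, (S q)ᴴ * S q = 1

variable {p : ℕ} {φ : ∀ q, Z q → ℂ} {θ : Z 0 → ℂ} {S : ∀ q, Matrix (Z q × Z q) (Z (q + 1)) ℂ}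

lemma IsTree.sum_treeRow_le (h : IsTree p φ θ S) {q : ℕ} (hq : q ≤ p) (x : Z q → ℂ) :
    ∑ b, ‖treeRow φ θ S q b ⬝ᵥ x‖ ^ 2 ≤ nsq x := by
  induction q with
  | zero =>
    rw [sum_bits_one, treeRow_zero_false, treeRow_zero_true, ← Matrix.dotProduct_mulVec]
    have h1 := norm_dotProduct_sq_le θ (coproj (φ 0) *ᵥ x)
    have h2 := nsq_coproj_mulVec_le (h.prep 0 hq) x
    nlinarith [nsq_nonneg (coproj (φ 0) *ᵥ x), h.leaf]
  | succ q ih =>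
    have hq' : q ≤ p := by omega
    have h1 : ∑ b, ‖treeRow φ θ S (q + 1) b ⬝ᵥ x‖ ^ 2 ≤ ‖star (φ (q + 1)) ⬝ᵥ x‖ ^ 2 +
        ∑ b₁, ∑ b₂, ‖treeRow φ θ S q b₂ ⬝ᵥ contract (treeRow φ θ S q b₁)
          (S q *ᵥ (coproj (φ (q + 1)) *ᵥ x))‖ ^ 2 := by
      rw [← sum_bits_succ (fun b => ‖treeRow φ θ S q (secondHalf b) ⬝ᵥ
        contract (treeRow φ θ S q (firstHalf b)) (S q *ᵥ (coproj (φ (q + 1)) *ᵥ x))‖ ^ 2) _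
        fun b => rfl, ← Finset.add_sum_erase _ _ (Finset.mem_univ (zeroBits (2 ^ (q + 1)))),
        treeRow_zeroBits]
      gcongr ‖_‖ ^ 2 + ?_
      refine (Finset.sum_le_sum fun b hb => ?_).trans (Finset.sum_le_sum_of_subset_of_nonneg
        (Finset.erase_subset (zeroBits (2 ^ (q + 1))) _) fun _ _ _ => by positivity)
      rw [treeRow_succ_dotProduct φ θ S (Finset.ne_of_mem_erase hb)]
    have h2 := sum_contract_le (fun x => ih hq' x) (fun x => ih hq' x)
      (S q *ᵥ (coproj (φ (q + 1)) *ᵥ x))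
    rw [nsq_mulVec_of_isometry (h.split q (by omega))] at h2
    have h3 := nsq_coproj_mulVec_le (h.prep (q + 1) hq) x
    linarith

end Trees

section Comparison

variable {Z Y : ℕ → Type} [∀ q, Fintype (Z q)] [∀ q, DecidableEq (Z q)]
  [∀ q, Fintype (Y q)] [∀ q, DecidableEq (Y q)]

/-- The tree `(χ, η, T)` is embedded by the isometries `V` in the tree `(φ, θ, S)`, up to an error
`d` in each preparation vector. -/
structure IsApproxEmbedding (p : ℕ) (d : ℝ) (V : ∀ q, Matrix (Z q) (Y q) ℂ)
    (φ : ∀ q, Z q → ℂ) (θ : Z 0 → ℂ) (S : ∀ q, Matrix (Z q × Z q) (Z (q + 1)) ℂ)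
    (χ : ∀ q, Y q → ℂ) (η : Y 0 → ℂ) (T : ∀ q, Matrix (Y q × Y q) (Y (q + 1)) ℂ) : Prop where
  isometry : ∀ q ≤ p, (V q)ᴴ * V q = 1
  prep : ∀ q ≤ p, nsq (φ q - V q *ᵥ χ q) ≤ d ^ 2
  leaf : θ ᵥ* V 0 = η
  split : ∀ q < p, S q * V (q + 1) = (V q ⊗ₖ V q) * T q

variable {p : ℕ} {d : ℝ} {V : ∀ q, Matrix (Z q) (Y q) ℂ}
    {φ : ∀ q, Z q → ℂ} {θ : Z 0 → ℂ} {S : ∀ q, Matrix (Z q × Z q) (Z (q + 1)) ℂ}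
    {χ : ∀ q, Y q → ℂ} {η : Y 0 → ℂ} {T : ∀ q, Matrix (Y q × Y q) (Y (q + 1)) ℂ}

/-- `I - |φ⟩⟨φ|` intertwines with `I - |χ⟩⟨χ|` up to the distance of `φ` from the image of `χ`. -/
lemma nsq_coproj_sub_le {X W : Type*} [Fintype X] [Fintype W] [DecidableEq X] [DecidableEq W]
    {V : Matrix X W ℂ} (hV : Vᴴ * V = 1) {φ : X → ℂ} {χ : W → ℂ} (hφ : nsq φ ≤ 1)
    (hχ : nsq χ ≤ 1) (x : W → ℂ) :
    nsq (coproj φ *ᵥ (V *ᵥ x) - V *ᵥ (coproj χ *ᵥ x)) ≤ 4 * nsq (φ - V *ᵥ χ) * nsq x := by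
  have e : coproj φ *ᵥ (V *ᵥ x) - V *ᵥ (coproj χ *ᵥ x) =
      -((star (φ - V *ᵥ χ) ⬝ᵥ (V *ᵥ x)) • (V *ᵥ χ)) +
      -((star φ ⬝ᵥ (V *ᵥ x)) • (φ - V *ᵥ χ)) := by
    have e1 : star (V *ᵥ χ) ⬝ᵥ (V *ᵥ x) = star χ ⬝ᵥ x := by
      rw [Matrix.star_mulVec, ← Matrix.dotProduct_mulVec, Matrix.mulVec_mulVec, hV,
        Matrix.one_mulVec]
    rw [coproj_mulVec, coproj_mulVec, Matrix.mulVec_sub, Matrix.mulVec_smul, star_sub,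
      sub_dotProduct, e1]
    module
  rw [e]
  refine (nsq_add_le _ _).trans ?_
  rw [← neg_smul, ← neg_smul, nsq_smul, nsq_smul, norm_neg, norm_neg,
    nsq_mulVec_of_isometry hV]
  have h1 := norm_dotProduct_sq_le (star (φ - V *ᵥ χ)) (V *ᵥ x)
  have h2 := norm_dotProduct_sq_le (star φ) (V *ᵥ x)
  rw [nsq_star, nsq_mulVec_of_isometry hV] at h1 h2
  have h3 := nsq_nonneg (φ - V *ᵥ χ)
  have h4 := nsq_nonneg x
  have h5 : ‖star (φ - V *ᵥ χ) ⬝ᵥ (V *ᵥ x)‖ ^ 2 * nsq χ ≤ nsq (φ - V *ᵥ χ) * nsq x * 1 :=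
    mul_le_mul h1 hχ (nsq_nonneg _) (by positivity)
  have h6 : ‖star φ ⬝ᵥ (V *ᵥ x)‖ ^ 2 * nsq (φ - V *ᵥ χ) ≤ 1 * nsq x * nsq (φ - V *ᵥ χ) := by
    gcongr
    exact h2.trans (by gcongr)
  nlinarith

/-- Cauchy-Schwarz for three terms with the weights `1`, `n₁` and `n₂`. -/
lemma sq_add_three_div_le {a b c n₁ n₂ n : ℝ} (h₁ : 0 < n₁) (h₂ : 0 < n₂)
    (h : 1 + n₁ + n₂ ≤ n) :
    (a + b + c) ^ 2 / n ≤ a ^ 2 + b ^ 2 / n₁ + c ^ 2 / n₂ := by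
  rw [div_le_iff₀ (by linarith)]
  have hb : b ^ 2 = b ^ 2 / n₁ * n₁ := by field_simp
  have hc : c ^ 2 = c ^ 2 / n₂ * n₂ := by field_simp
  calc (a + b + c) ^ 2 ≤ (a ^ 2 + b ^ 2 / n₁ + c ^ 2 / n₂) * (1 + n₁ + n₂) := by
        have : (a ^ 2 + b ^ 2 / n₁ + c ^ 2 / n₂) * (1 + n₁ + n₂) - (a + b + c) ^ 2
            = (n₁ * a - b) ^ 2 / n₁ + (n₂ * a - c) ^ 2 / n₂
              + (n₂ * b - n₁ * c) ^ 2 / (n₁ * n₂) := by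
          field_simp
          ring
        have : 0 ≤ (n₁ * a - b) ^ 2 / n₁ + (n₂ * a - c) ^ 2 / n₂
          + (n₂ * b - n₁ * c) ^ 2 / (n₁ * n₂) := by positivity
        linarith
    _ ≤ _ := by gcongr

/-- Error of the tree `(φ, θ, S)` against `(χ, η, T)` in the amplitude of the outcome `b`. -/
def treeErr (V : ∀ q, Matrix (Z q) (Y q) ℂ)
    (φ : ∀ q, Z q → ℂ) (θ : Z 0 → ℂ) (S : ∀ q, Matrix (Z q × Z q) (Z (q + 1)) ℂ)
    (χ : ∀ q, Y q → ℂ) (η : Y 0 → ℂ) (T : ∀ q, Matrix (Y q × Y q) (Y (q + 1)) ℂ)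
    (q : ℕ) (b : Bits (2 ^ q)) (x : Y q → ℂ) : ℂ :=
  treeRow φ θ S q b ⬝ᵥ (V q *ᵥ x) - treeRow χ η T q b ⬝ᵥ x

/-- Potential that bounds the expected number of measurements when the tree `(χ, η, T)`
is run on `x` and at most `h` ones are to be found. The part of `x` that is found to have fewer than
`h + 1` ones needs fewer measurements; the subtracted sum returns what it does not use, and this
makes the bound additive along the two halves of a block. -/
def treePot (χ : ∀ q, Y q → ℂ) (η : Y 0 → ℂ) (T : ∀ q, Matrix (Y q × Y q) (Y (q + 1)) ℂ)
    (q h : ℕ) (x : Y q → ℂ) : ℝ :=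
  (1 + 2 * q * (h + 1)) * nsq x
    - 2 * q * ∑ b with wt b ≤ h, ((h : ℝ) + 1 - wt b) * ‖treeRow χ η T q b ⬝ᵥ x‖ ^ 2

lemma sum_bits_succ_filter {q h : ℕ} (G : Bits (2 ^ q) → Bits (2 ^ q) → ℝ) :
    ∑ b : Bits (2 ^ (q + 1)) with wt b ≤ h, G (firstHalf b) (secondHalf b) =
      ∑ b₁ with wt b₁ ≤ h, ∑ b₂ with wt b₂ ≤ h - wt b₁, G b₁ b₂ := by
  rw [Finset.sum_filter, Finset.sum_filter, sum_bits_succ _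
    (fun b₁ b₂ => if wt b₁ + wt b₂ ≤ h then G b₁ b₂ else 0) fun b => by rw [wt_halves]]
  refine Finset.sum_congr rfl fun b₁ _ => ?_
  rw [Finset.sum_filter]
  split_ifs with h1
  · refine Finset.sum_congr rfl fun b₂ _ => ?_
    have : wt b₁ + wt b₂ ≤ h ↔ wt b₂ ≤ h - wt b₁ := by omega
    simp only [this]
  · refine Finset.sum_eq_zero fun b₂ _ => if_neg (by omega)

/-- Recursion of the potential: the node itself, the first half and the second half. -/
lemma treePot_succ (hT : IsTree p χ η T) {q : ℕ} (hq : q + 1 ≤ p) (h : ℕ)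
    (x : Y (q + 1) → ℂ) (y : Y q × Y q → ℂ) (hy : y = T q *ᵥ (coproj (χ (q + 1)) *ᵥ x)) :
    nsq x + ∑ j, treePot χ η T q h (fun i => y (i, j)) +
      ∑ b₁ with wt b₁ ≤ h, treePot χ η T q (h - wt b₁) (contract (treeRow χ η T q b₁) y)
      ≤ treePot χ η T (q + 1) h x := by
  set f := treeRow χ η T q with hf
  have hq' : q ≤ p := by omega
  -- weight of `y` and of its components
  have hY : nsq y ≤ nsq x - ‖star (χ (q + 1)) ⬝ᵥ x‖ ^ 2 := by
    rw [hy, nsq_mulVec_of_isometry (hT.split q (by omega))]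
    exact nsq_coproj_mulVec_le (hT.prep _ hq) x
  have hc : ∀ b, nsq (contract (f b) y) = ∑ j, ‖f b ⬝ᵥ fun i => y (i, j)‖ ^ 2 := fun b => rfl
  have h1 : ∑ j, treePot χ η T q h (fun i => y (i, j)) = (1 + 2 * q * (h + 1)) * nsq y
      - 2 * q * ∑ b with wt b ≤ h, ((h : ℝ) + 1 - wt b) * nsq (contract (f b) y) := by
    simp only [treePot, Finset.sum_sub_distrib, ← Finset.mul_sum, ← nsq_prod, hc]
    rw [Finset.sum_comm]
    simp only [← Finset.mul_sum]
    rfl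
  have h2 : ∑ b₁ with wt b₁ ≤ h, treePot χ η T q (h - wt b₁) (contract (f b₁) y) =
      ∑ b₁ with wt b₁ ≤ h, (1 + 2 * q * ((h : ℝ) + 1 - wt b₁)) * nsq (contract (f b₁) y)
      - 2 * q * ∑ b : Bits (2 ^ (q + 1)) with wt b ≤ h, ((h : ℝ) + 1 - wt b) *
          ‖f (secondHalf b) ⬝ᵥ contract (f (firstHalf b)) y‖ ^ 2 := by
    have := sum_bits_succ_filter (q := q) (h := h) fun b₁ b₂ => ((h : ℝ) + 1 - (wt b₁ + wt b₂)) *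
          ‖f b₂ ⬝ᵥ contract (f b₁) y‖ ^ 2
    have e : ∀ b : Bits (2 ^ (q + 1)),
        (wt b : ℝ) = wt (firstHalf b) + wt (secondHalf b) := fun b => by
      rw [wt_halves, Nat.cast_add]
    simp only [e]
    rw [this, Finset.mul_sum, ← Finset.sum_sub_distrib]
    refine Finset.sum_congr rfl fun b₁ hb₁ => ?_
    have hb : wt b₁ ≤ h := by simpa using hb₁
    rw [treePot, Nat.cast_sub hb, ← hf]
    congr 1
    · ring
    · congr 1
      refine Finset.sum_congr rfl fun b₂ _ => by ring
  -- the zero outcome is a single leaf of the new tree, and the others keep their amplitudes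
  have h3 : ∀ g : Bits (2 ^ (q + 1)) → ℝ,
      ∑ b with wt b ≤ h, g b = g (zeroBits _) +
        ∑ b ∈ (Finset.univ.filter fun b => wt b ≤ h).erase (zeroBits (2 ^ (q + 1))), g b := by
    intro g
    exact (Finset.add_sum_erase _ _ (by simp [wt_zeroBits])).symm
  have h4 : ∑ b ∈ (Finset.univ.filter fun b => wt b ≤ h).erase (zeroBits (2 ^ (q + 1))),
        ((h : ℝ) + 1 - wt b) * ‖treeRow χ η T (q + 1) b ⬝ᵥ x‖ ^ 2 =
      ∑ b ∈ (Finset.univ.filter fun b => wt b ≤ h).erase (zeroBits (2 ^ (q + 1))),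
        ((h : ℝ) + 1 - wt b) * ‖f (secondHalf b) ⬝ᵥ contract (f (firstHalf b)) y‖ ^ 2 := by
    refine Finset.sum_congr rfl fun b hb => ?_
    rw [treeRow_succ_dotProduct χ η T (Finset.ne_of_mem_erase hb), hy]
  have hall : ∑ b₁, ∑ b₂, ‖f b₂ ⬝ᵥ contract (f b₁) y‖ ^ 2 ≤ nsq y :=
    sum_contract_le (fun x => hT.sum_treeRow_le hq' x) (fun x => hT.sum_treeRow_le hq' x) y
  have h5 : ∑ b ∈ (Finset.univ.filter fun b => wt b ≤ h).erase (zeroBits (2 ^ (q + 1))),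
        ((h : ℝ) + 1 - wt b) * ‖f (secondHalf b) ⬝ᵥ contract (f (firstHalf b)) y‖ ^ 2
        ≤ h * nsq y := by
    calc _ ≤ ∑ b ∈ (Finset.univ.filter fun b => wt b ≤ h).erase (zeroBits (2 ^ (q + 1))),
          (h : ℝ) * ‖f (secondHalf b) ⬝ᵥ contract (f (firstHalf b)) y‖ ^ 2 := by
          refine Finset.sum_le_sum fun b hb => ?_
          have : 1 ≤ wt b := Nat.one_le_iff_ne_zero.mpr
            fun h0 => Finset.ne_of_mem_erase hb (wt_eq_zero.mp h0)
          have : (1 : ℝ) ≤ wt b := by exact_mod_cast this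
          gcongr
          linarith
      _ ≤ ∑ b : Bits (2 ^ (q + 1)),
          (h : ℝ) * ‖f (secondHalf b) ⬝ᵥ contract (f (firstHalf b)) y‖ ^ 2 :=
          Finset.sum_le_sum_of_subset_of_nonneg (Finset.subset_univ _)
            fun _ _ _ => by positivity
      _ ≤ _ := by
          rw [← Finset.mul_sum,
            sum_bits_succ _ (fun b₁ b₂ => ‖f b₂ ⬝ᵥ contract (f b₁) y‖ ^ 2) fun b => rfl]
          gcongr
  have h6 : ∑ b₁ with wt b₁ ≤ h, nsq (contract (f b₁) y) ≤ nsq y := by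
    refine (Finset.sum_le_sum_of_subset_of_nonneg (Finset.subset_univ _)
      fun _ _ _ => nsq_nonneg _).trans ?_
    simp only [hc]
    rw [Finset.sum_comm, nsq_prod]
    exact Finset.sum_le_sum fun j _ => hT.sum_treeRow_le hq' _
  have h7 : ∑ b₁ with wt b₁ ≤ h, (1 + 2 * q * ((h : ℝ) + 1 - wt b₁)) * nsq (contract (f b₁) y)
      = ∑ b₁ with wt b₁ ≤ h, nsq (contract (f b₁) y) + 2 * q *
        ∑ b₁ with wt b₁ ≤ h, ((h : ℝ) + 1 - wt b₁) * nsq (contract (f b₁) y) := by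
    rw [Finset.mul_sum, ← Finset.sum_add_distrib]
    exact Finset.sum_congr rfl fun _ _ => by ring
  have h8 : 0 ≤ ((h : ℝ) + 1 - wt (zeroBits (2 ^ (q + 1)))) *
      ‖f (secondHalf (zeroBits (2 ^ (q + 1)))) ⬝ᵥ
        contract (f (firstHalf (zeroBits (2 ^ (q + 1))))) y‖ ^ 2 := by
    rw [wt_zeroBits, Nat.cast_zero, sub_zero]; positivity
  rw [h1, h2, h7, h3, treePot, h3, h4, treeRow_zeroBits, wt_zeroBits]
  rw [wt_zeroBits] at h8
  push_cast at h8 ⊢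
  set P := ∑ b ∈ (Finset.univ.filter fun b => wt b ≤ h).erase (zeroBits (2 ^ (q + 1))),
        ((h : ℝ) + 1 - wt b) * ‖f (secondHalf b) ⬝ᵥ contract (f (firstHalf b)) y‖ ^ 2
  have hq0 : (0 : ℝ) ≤ q := by positivity
  have h9 := mul_nonneg hq0 h8
  have h10 : (0 : ℝ) ≤ (q + 1) * (h + 1) * (nsq x - ‖star (χ (q + 1)) ⬝ᵥ x‖ ^ 2 - nsq y) :=
    mul_nonneg (by positivity) (by linarith)
  nlinarith

/-- The squared errors, divided by the number of measurements on the path of the outcome, are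
bounded by the potential. The error of an outcome is the sum of the errors at the root, in the first
half and in the second half, and Cauchy-Schwarz distributes the square over the three. -/
lemma sum_treeErr_le (hS : IsTree p φ θ S) (hT : IsTree p χ η T)
    (hV : IsApproxEmbedding p d V φ θ S χ η T) {q : ℕ} (hq : q ≤ p) (h : ℕ) (x : Y q → ℂ) :
    ∑ b with wt b ≤ h, ‖treeErr V φ θ S χ η T q b x‖ ^ 2 / (1 + 2 * q * wt b)
      ≤ 5 * d ^ 2 * treePot χ η T q h x := by
  -- the outcome zero
  have hzero : ∀ q ≤ p, ∀ x : Y q → ℂ,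
      ‖treeErr V φ θ S χ η T q (zeroBits _) x‖ ^ 2 ≤ d ^ 2 * nsq x := by
    intro q hq x
    have : treeErr V φ θ S χ η T q (zeroBits _) x = star (φ q - V q *ᵥ χ q) ⬝ᵥ (V q *ᵥ x) := by
      rw [treeErr, treeRow_zeroBits, treeRow_zeroBits, star_sub, sub_dotProduct,
        Matrix.star_mulVec (V q), ← Matrix.dotProduct_mulVec (star (χ q)), Matrix.mulVec_mulVec,
        hV.isometry q hq, Matrix.one_mulVec]
    rw [this]
    refine (norm_dotProduct_sq_le _ _).trans ?_
    rw [nsq_star, nsq_mulVec_of_isometry (hV.isometry q hq)]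
    gcongr
    · exact nsq_nonneg _
    · exact hV.prep q hq
  have hcop : ∀ q ≤ p, ∀ x : Y q → ℂ,
      nsq (coproj (φ q) *ᵥ (V q *ᵥ x) - V q *ᵥ (coproj (χ q) *ᵥ x)) ≤ 4 * d ^ 2 * nsq x := by
    intro q hq x
    refine (nsq_coproj_sub_le (hV.isometry q hq) (hS.prep q hq) (hT.prep q hq) x).trans ?_
    gcongr
    · exact nsq_nonneg _
    · exact hV.prep q hq
  induction q generalizing h with
  | zero =>
    have h1 : ‖treeErr V φ θ S χ η T 0 (fun _ => true) x‖ ^ 2 ≤ 4 * d ^ 2 * nsq x := by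
      have : treeErr V φ θ S χ η T 0 (fun _ => true) x =
          θ ⬝ᵥ (coproj (φ 0) *ᵥ (V 0 *ᵥ x) - V 0 *ᵥ (coproj (χ 0) *ᵥ x)) := by
        rw [treeErr, treeRow_zero_true, treeRow_zero_true, ← Matrix.dotProduct_mulVec,
          ← Matrix.dotProduct_mulVec, dotProduct_sub, Matrix.dotProduct_mulVec θ (V 0), hV.leaf]
      rw [this]
      refine (norm_dotProduct_sq_le _ _).trans ((mul_le_mul hS.leaf (hcop 0 hq x)
        (nsq_nonneg _) zero_le_one).trans (by rw [one_mul]))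
    have h0 := hzero 0 hq x
    calc _ ≤ ∑ b, ‖treeErr V φ θ S χ η T 0 b x‖ ^ 2 := by
          refine (Finset.sum_le_sum_of_subset_of_nonneg (Finset.filter_subset _ _)
            fun _ _ _ => by positivity).trans (le_of_eq ?_)
          simp
      _ ≤ 5 * d ^ 2 * nsq x := by
          rw [sum_bits_one]
          change ‖treeErr V φ θ S χ η T 0 (zeroBits _) x‖ ^ 2 + _ ≤ _
          linarith
      _ = _ := by simp [treePot]
  | succ q ih =>
    have hq' : q ≤ p := by omega
    set f := treeRow φ θ S q
    set c := treeRow χ η T q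
    set y := T q *ᵥ (coproj (χ (q + 1)) *ᵥ x) with hy
    set z := S q *ᵥ (coproj (φ (q + 1)) *ᵥ (V (q + 1) *ᵥ x)) - (V q ⊗ₖ V q) *ᵥ y with hz
    set e : Bits (2 ^ q) → Y q → ℂ := fun b₁ j => treeErr V φ θ S χ η T q b₁ fun i => y (i, j)
    have hzle : nsq z ≤ 4 * d ^ 2 * nsq x := by
      have : z = S q *ᵥ (coproj (φ (q + 1)) *ᵥ (V (q + 1) *ᵥ x) -
          V (q + 1) *ᵥ (coproj (χ (q + 1)) *ᵥ x)) := by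
        rw [hz, hy, Matrix.mulVec_sub, Matrix.mulVec_mulVec _ (S q) (V (q + 1)),
          hV.split q (by omega), ← Matrix.mulVec_mulVec _ (V q ⊗ₖ V q) (T q)]
      rw [this, nsq_mulVec_of_isometry (hS.split q (by omega))]
      exact hcop (q + 1) hq x
    -- decomposition of the error: this node, the first half, the second half
    have herr : ∀ b : Bits (2 ^ (q + 1)), b ≠ zeroBits _ → treeErr V φ θ S χ η T (q + 1) b x =
        f (secondHalf b) ⬝ᵥ contract (f (firstHalf b)) z
        + f (secondHalf b) ⬝ᵥ (V q *ᵥ e (firstHalf b))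
        + treeErr V φ θ S χ η T q (secondHalf b) (contract (c (firstHalf b)) y) := by
      intro b hb
      have e1 : S q *ᵥ (coproj (φ (q + 1)) *ᵥ (V (q + 1) *ᵥ x)) =
          z + (V q ⊗ₖ V q) *ᵥ y := by rw [hz, sub_add_cancel]
      have e2 : contract (f (firstHalf b)) (z + (V q ⊗ₖ V q) *ᵥ y) =
          contract (f (firstHalf b)) z + V q *ᵥ (e (firstHalf b)
            + contract (c (firstHalf b)) y) := by
        have : ∀ u v : Z q × Z q → ℂ, contract (f (firstHalf b)) (u + v) =
            contract (f (firstHalf b)) u + contract (f (firstHalf b)) v := by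
          intro u v
          ext j
          exact dotProduct_add _ _ _
        rw [this, contract_kronecker_mulVec]
        congr 2
        ext j
        simp [e, treeErr, contract, f, c]
      rw [treeErr, treeRow_succ_dotProduct _ _ _ hb, treeRow_succ_dotProduct _ _ _ hb, e1, e2,
        treeErr, Matrix.mulVec_add, dotProduct_add, dotProduct_add]
      ring
    have hterm : ∀ b : Bits (2 ^ (q + 1)), b ≠ zeroBits _ →
        ‖treeErr V φ θ S χ η T (q + 1) b x‖ ^ 2 / (1 + 2 * ((q + 1 : ℕ) : ℝ) * wt b) ≤
        ‖f (secondHalf b) ⬝ᵥ contract (f (firstHalf b)) z‖ ^ 2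
        + ‖f (secondHalf b) ⬝ᵥ (V q *ᵥ e (firstHalf b))‖ ^ 2 / (1 + 2 * q * wt (firstHalf b))
        + ‖treeErr V φ θ S χ η T q (secondHalf b) (contract (c (firstHalf b)) y)‖ ^ 2 /
          (1 + 2 * q * wt (secondHalf b)) := by
      intro b hb
      have h1 : 1 ≤ wt b := Nat.one_le_iff_ne_zero.mpr fun h0 => hb (wt_eq_zero.mp h0)
      have h1 : (1 : ℝ) ≤ wt b := by exact_mod_cast h1
      refine le_trans ?_ (sq_add_three_div_le (n := 1 + 2 * ((q + 1 : ℕ) : ℝ) * wt b)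
        (n₁ := 1 + 2 * (q : ℝ) * wt (firstHalf b)) (n₂ := 1 + 2 * (q : ℝ) * wt (secondHalf b))
        (by positivity) (by positivity) ?_)
      · rw [herr b hb]
        gcongr
        exact (norm_add_le _ _).trans (by gcongr; exact norm_add_le _ _)
      · rw [wt_halves] at h1 ⊢
        push_cast at h1 ⊢
        nlinarith
    have hA : ∑ b : Bits (2 ^ (q + 1)) with wt b ≤ h,
        ‖f (secondHalf b) ⬝ᵥ contract (f (firstHalf b)) z‖ ^ 2 ≤ 4 * d ^ 2 * nsq x := by
      refine (Finset.sum_le_sum_of_subset_of_nonneg (Finset.subset_univ _)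
        fun _ _ _ => by positivity).trans ?_
      rw [sum_bits_succ _ (fun b₁ b₂ => ‖f b₂ ⬝ᵥ contract (f b₁) z‖ ^ 2) fun b => rfl]
      exact (sum_contract_le (fun x => hS.sum_treeRow_le hq' x)
        (fun x => hS.sum_treeRow_le hq' x) z).trans hzle
    have hB : ∑ b : Bits (2 ^ (q + 1)) with wt b ≤ h,
        ‖f (secondHalf b) ⬝ᵥ (V q *ᵥ e (firstHalf b))‖ ^ 2 / (1 + 2 * q * wt (firstHalf b))
        ≤ 5 * d ^ 2 * ∑ j, treePot χ η T q h (fun i => y (i, j)) := by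
      rw [sum_bits_succ_filter fun b₁ b₂ =>
        ‖f b₂ ⬝ᵥ (V q *ᵥ e b₁)‖ ^ 2 / (1 + 2 * (q : ℝ) * wt b₁)]
      calc _ ≤ ∑ b₁ with wt b₁ ≤ h, nsq (e b₁) / (1 + 2 * (q : ℝ) * wt b₁) := by
            refine Finset.sum_le_sum fun b₁ _ => ?_
            rw [← Finset.sum_div]
            gcongr
            rw [← nsq_mulVec_of_isometry (hV.isometry q hq') (e b₁)]
            exact (Finset.sum_le_sum_of_subset_of_nonneg (Finset.subset_univ _)
              fun _ _ _ => by positivity).trans (hS.sum_treeRow_le hq' _)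
        _ = ∑ j, ∑ b₁ with wt b₁ ≤ h, ‖e b₁ j‖ ^ 2 / (1 + 2 * (q : ℝ) * wt b₁) := by
            simp only [nsq, Finset.sum_div]
            rw [Finset.sum_comm]
        _ ≤ _ := by
            rw [Finset.mul_sum]
            exact Finset.sum_le_sum fun j _ => ih hq' h _
    have hC : ∑ b : Bits (2 ^ (q + 1)) with wt b ≤ h,
        ‖treeErr V φ θ S χ η T q (secondHalf b) (contract (c (firstHalf b)) y)‖ ^ 2 /
          (1 + 2 * q * wt (secondHalf b)) ≤ 5 * d ^ 2 *
        ∑ b₁ with wt b₁ ≤ h, treePot χ η T q (h - wt b₁) (contract (c b₁) y) := by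
      rw [sum_bits_succ_filter fun b₁ b₂ =>
        ‖treeErr V φ θ S χ η T q b₂ (contract (c b₁) y)‖ ^ 2 / (1 + 2 * (q : ℝ) * wt b₂),
        Finset.mul_sum]
      exact Finset.sum_le_sum fun b₁ _ => ih hq' _ _
    have hpot := treePot_succ hT hq h x y hy
    have hd : 0 ≤ 5 * d ^ 2 := by positivity
    have hmem : zeroBits (2 ^ (q + 1)) ∈ Finset.univ.filter fun b => wt b ≤ h := by
      simp [wt_zeroBits]
    rw [← Finset.add_sum_erase _ _ hmem, wt_zeroBits]
    have hrest := (Finset.sum_le_sum fun b hb => hterm b (Finset.ne_of_mem_erase hb)).trans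
      (Finset.sum_le_sum_of_subset_of_nonneg (Finset.erase_subset (zeroBits (2 ^ (q + 1)))
        (Finset.univ.filter fun b => wt b ≤ h)) fun _ _ _ => by positivity)
    rw [Finset.sum_add_distrib, Finset.sum_add_distrib] at hrest
    have h0 := hzero (q + 1) hq x
    have := mul_le_mul_of_nonneg_left hpot hd
    simp only [Nat.cast_zero, mul_zero, add_zero, div_one]
    linarith

/-- Along an approximate embedding, the amplitudes of all outcomes with at most `h` ones differ
in `ℓ²` by at most a multiple of the number `1 + 2 q (h + 1)` of measurements on a path. -/
lemma sum_treeErr_sq_le (hS : IsTree p φ θ S) (hT : IsTree p χ η T)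
    (hV : IsApproxEmbedding p d V φ θ S χ η T) {q : ℕ} (hq : q ≤ p) (h : ℕ) (x : Y q → ℂ) :
    ∑ b with wt b ≤ h, ‖treeErr V φ θ S χ η T q b x‖ ^ 2
      ≤ 5 * d ^ 2 * (1 + 2 * q * (h + 1)) ^ 2 * nsq x := by
  have h1 := sum_treeErr_le hS hT hV hq h x
  have hpot : treePot χ η T q h x ≤ (1 + 2 * q * (h + 1)) * nsq x := by
    rw [treePot, sub_le_self_iff]
    refine mul_nonneg (by positivity) (Finset.sum_nonneg fun b hb => ?_)
    have : (wt b : ℝ) ≤ h := by exact_mod_cast (by simpa using hb : wt b ≤ h)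
    exact mul_nonneg (by linarith) (by positivity)
  calc _ ≤ ∑ b with wt b ≤ h, (1 + 2 * q * ((h : ℝ) + 1)) *
        (‖treeErr V φ θ S χ η T q b x‖ ^ 2 / (1 + 2 * q * wt b)) := by
        refine Finset.sum_le_sum fun b hb => ?_
        have : (wt b : ℝ) ≤ h := by exact_mod_cast (by simpa using hb : wt b ≤ h)
        rw [mul_div_assoc', le_div_iff₀ (by positivity), mul_comm]
        gcongr
        linarith
    _ ≤ (1 + 2 * q * ((h : ℝ) + 1)) * (5 * d ^ 2 * ((1 + 2 * q * (h + 1)) * nsq x)) := by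
        rw [← Finset.mul_sum]
        gcongr
        exact h1.trans (by gcongr)
    _ = _ := by ring

end Comparison

/-! ### Trace norm and positive maps -/

open scoped ComplexOrder

section TraceNorm

variable {ι : Type*} [Fintype ι] [DecidableEq ι]

/-- The squares of the eigenvalues of a Hermitian `M` are the eigenvalues of `Mᴴ M`. -/
lemma traceNorm_of_isHermitian {M : Matrix ι ι ℂ} (hM : M.IsHermitian) :
    traceNorm M = ∑ i, |hM.eigenvalues i| := by
  have hsq := Matrix.isHermitian_conjTranspose_mul_self M
  have hchar : (Mᴴ * M).charpoly
      = (Matrix.diagonal fun i => ((hM.eigenvalues i ^ 2 : ℝ) : ℂ)).charpoly := by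
    have h2 : Mᴴ * M = Unitary.conjStarAlgAut ℂ _ hM.eigenvectorUnitary
        (Matrix.diagonal fun i => ((hM.eigenvalues i ^ 2 : ℝ) : ℂ)) := by
      have h3 : (Matrix.diagonal fun i => ((hM.eigenvalues i ^ 2 : ℝ) : ℂ)) =
          Matrix.diagonal (RCLike.ofReal ∘ hM.eigenvalues) *
            Matrix.diagonal (RCLike.ofReal ∘ hM.eigenvalues) := by
        simp [Matrix.diagonal_mul_diagonal, sq]
      rw [h3, map_mul, ← hM.spectral_theorem, hM.eq]
    rw [h2, Unitary.conjStarAlgAut_apply, Matrix.charpoly_mul_comm, ← mul_assoc]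
    simp
  have hroots : Multiset.map (fun i => hsq.eigenvalues i) Finset.univ.val
      = Multiset.map (fun i => hM.eigenvalues i ^ 2) Finset.univ.val := by
    have h1 := hsq.roots_charpoly_eq_eigenvalues
    rw [hchar, Matrix.charpoly_diagonal, Polynomial.roots_prod _ _
      (Finset.prod_ne_zero_iff.mpr fun i _ => Polynomial.X_sub_C_ne_zero _)] at h1
    simp only [Polynomial.roots_X_sub_C, Multiset.bind_singleton] at h1
    have h2 := congrArg (Multiset.map Complex.re) h1
    simp only [Multiset.map_map, Function.comp_def, Complex.ofReal_re] at h2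
    exact h2.symm
  have h3 := congrArg (fun s => (Multiset.map Real.sqrt s).sum) hroots
  simp only [Multiset.map_map, Function.comp_def, Real.sqrt_sq_eq_abs] at h3
  exact h3

lemma traceNorm_sub_le {P N : Matrix ι ι ℂ} (hP : P.PosSemidef) (hN : N.PosSemidef) :
    traceNorm (P - N) ≤ P.trace.re + N.trace.re := by
  have hM : (P - N).IsHermitian := hP.1.sub hN.1
  have htr : ∀ Q : Matrix ι ι ℂ, Q.trace.re = ∑ i, (star ⇑(hM.eigenvectorBasis i) ⬝ᵥ
      (Q *ᵥ ⇑(hM.eigenvectorBasis i))).re := by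
    intro Q
    have hU : (hM.eigenvectorUnitary : Matrix ι ι ℂ) * star (hM.eigenvectorUnitary : Matrix ι ι ℂ)
        = 1 := Unitary.mul_star_self_of_mem hM.eigenvectorUnitary.2
    have h1 : Q.trace = (star (hM.eigenvectorUnitary : Matrix ι ι ℂ) *
        (Q * (hM.eigenvectorUnitary : Matrix ι ι ℂ))).trace := by
      rw [Matrix.trace_mul_comm, Matrix.mul_assoc, hU, Matrix.mul_one]
    rw [h1, Matrix.trace, Complex.re_sum]
    refine Finset.sum_congr rfl fun i _ => ?_
    congr 1
  rw [traceNorm_of_isHermitian hM, htr P, htr N, ← Finset.sum_add_distrib]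
  refine Finset.sum_le_sum fun i _ => ?_
  have h1 := (Complex.le_def.mp (hP.dotProduct_mulVec_nonneg ⇑(hM.eigenvectorBasis i))).1
  have h2 := (Complex.le_def.mp (hN.dotProduct_mulVec_nonneg ⇑(hM.eigenvectorBasis i))).1
  have h3 := hM.eigenvalues_eq i
  rw [Matrix.sub_mulVec, dotProduct_sub] at h3
  simp only [Complex.zero_re, RCLike.re_to_complex, Complex.sub_re] at h1 h2 h3
  rw [h3, abs_le]
  constructor <;> linarith

lemma posSemidef_pureState (ψ : ι → ℂ) : (pureState ψ).PosSemidef :=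
  Matrix.posSemidef_vecMulVec_self_star ψ

lemma trace_pureState (ψ : ι → ℂ) : (pureState ψ).trace = nsq ψ := by
  rw [pureState, Matrix.trace_vecMulVec, dotProduct_comm, ofReal_nsq]

/-- The difference of two pure states as a difference of positive operators.  The scale `s` is
free, so that one choice serves a whole family of pairs. -/
lemma exists_pureState_sub_eq (u v : ι → ℂ) {s : ℝ} (hs : 0 < s) :
    ∃ P N : Matrix ι ι ℂ, P.PosSemidef ∧ N.PosSemidef ∧ pureState u - pureState v = P - N ∧
      P.trace.re + N.trace.re = (s * nsq (u + v) + nsq (u - v) / s) / 2 := by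
  set r : ℝ := Real.sqrt s with hr
  have hr0 : 0 < r := Real.sqrt_pos.mpr hs
  have hrs : r ^ 2 = s := Real.sq_sqrt hs.le
  set a : ι → ℂ := (r / 2 : ℂ) • (u + v) with ha
  set b : ι → ℂ := (1 / (2 * r) : ℂ) • (u - v) with hb
  refine ⟨pureState (a + b), pureState (a - b), posSemidef_pureState _, posSemidef_pureState _,
    ?_, ?_⟩
  · have hrc : (r : ℂ) ≠ 0 := by exact_mod_cast hr0.ne'
    ext i j
    simp only [pureState, Matrix.sub_apply, Matrix.vecMulVec_apply, ha, hb, Pi.add_apply,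
      Pi.sub_apply, Pi.smul_apply, Pi.star_apply, smul_eq_mul, star_add, star_sub, star_mul',
      Complex.star_def, map_div₀, map_mul, Complex.conj_ofReal, map_ofNat, map_one]
    field_simp
    ring
  · rw [trace_pureState, trace_pureState, Complex.ofReal_re, Complex.ofReal_re]
    have hpar : nsq (a + b) + nsq (a - b) = 2 * nsq a + 2 * nsq b := by
      simp only [nsq_eq_norm_sq, WithLp.toLp_add, WithLp.toLp_sub]
      have := parallelogram_law_with_norm ℂ (WithLp.toLp 2 a) (WithLp.toLp 2 b)
      nlinarith
    rw [hpar, ha, hb, nsq_smul, nsq_smul, ← hrs]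
    have h1 : ‖(r / 2 : ℂ)‖ = r / 2 := by simp [abs_of_pos hr0]
    have h2 : ‖(1 / (2 * r) : ℂ)‖ = 1 / (2 * r) := by simp [abs_of_pos hr0]
    rw [h1, h2]
    field_simp

end TraceNorm

section Maps

variable {ι κ E : Type*} [Fintype ι] [Fintype κ] [Fintype E] [DecidableEq E]

lemma applyLeft_sub (K : Matrix κ ι ℂ) (ρ σ : Matrix (ι × E) (ι × E) ℂ) :
    applyLeft K (ρ - σ) = applyLeft K ρ - applyLeft K σ := by
  simp [applyLeft, Matrix.mul_sub, Matrix.sub_mul]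

lemma posSemidef_applyLeft (K : Matrix κ ι ℂ) {ρ : Matrix (ι × E) (ι × E) ℂ}
    (hρ : ρ.PosSemidef) : (applyLeft K ρ).PosSemidef :=
  hρ.mul_mul_conjTranspose_same _

lemma traceLeft_sub (ρ σ : Matrix (ι × E) (ι × E) ℂ) :
    traceLeft (ρ - σ) = traceLeft ρ - traceLeft σ := by
  ext e e'
  simp [traceLeft]

lemma posSemidef_traceLeft {ρ : Matrix (ι × E) (ι × E) ℂ} (hρ : ρ.PosSemidef) :
    (traceLeft ρ).PosSemidef := by
  have : traceLeft ρ = ∑ i, ρ.submatrix (fun e => (i, e)) fun e => (i, e) := by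
    ext e e'
    simp [traceLeft, Matrix.sum_apply]
  rw [this]
  exact Matrix.posSemidef_sum _ fun i _ => hρ.submatrix _

lemma trace_traceLeft (ρ : Matrix (ι × E) (ι × E) ℂ) : (traceLeft ρ).trace = ρ.trace := by
  simp only [Matrix.trace, traceLeft, Matrix.diag_apply, Fintype.sum_prod_type]
  rw [Finset.sum_comm]

lemma trace_applyLeft (K : Matrix κ ι ℂ) (ρ : Matrix (ι × E) (ι × E) ℂ) :
    (applyLeft K ρ).trace = (((Kᴴ * K) ⊗ₖ (1 : Matrix E E ℂ)) * ρ).trace := by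
  rw [applyLeft, Matrix.trace_mul_comm, ← Matrix.mul_assoc, Matrix.conjTranspose_kronecker,
    ← Matrix.mul_kronecker_mul]
  simp

/-- The matrix of `f ⊗ I` for a row vector `f`. -/
def rowMatrix (E : Type*) [DecidableEq E] (f : ι → ℂ) : Matrix E (ι × E) ℂ :=
  fun e z => if e = z.2 then f z.1 else 0

/-- `ρ ↦ (f ⊗ I) ρ (f ⊗ I)†` for a row vector `f`. -/
def applyRow (f : ι → ℂ) (ρ : Matrix (ι × E) (ι × E) ℂ) : Matrix E E ℂ :=
  rowMatrix E f * ρ * (rowMatrix E f)ᴴ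

lemma applyRow_sub (f : ι → ℂ) (ρ σ : Matrix (ι × E) (ι × E) ℂ) :
    applyRow f (ρ - σ) = applyRow f ρ - applyRow f σ := by
  simp [applyRow, Matrix.mul_sub, Matrix.sub_mul]

lemma posSemidef_applyRow (f : ι → ℂ) {ρ : Matrix (ι × E) (ι × E) ℂ}
    (hρ : ρ.PosSemidef) : (applyRow f ρ).PosSemidef :=
  hρ.mul_mul_conjTranspose_same _

lemma rowMatrix_mul_kronecker (f : κ → ℂ) (K : Matrix κ ι ℂ) :
    rowMatrix E f * (K ⊗ₖ (1 : Matrix E E ℂ)) = rowMatrix E (f ᵥ* K) := by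
  ext e ⟨i, e'⟩
  simp [Matrix.mul_apply, rowMatrix, Fintype.sum_prod_type, Matrix.vecMul, dotProduct,
    Matrix.one_apply]

lemma applyRow_applyLeft (f : κ → ℂ) (K : Matrix κ ι ℂ) (ρ : Matrix (ι × E) (ι × E) ℂ) :
    applyRow f (applyLeft K ρ) = applyRow (f ᵥ* K) ρ := by
  rw [applyRow, applyRow, applyLeft, ← rowMatrix_mul_kronecker, Matrix.conjTranspose_mul]
  simp only [Matrix.mul_assoc]

lemma applyRow_smul (c : ℂ) (f : ι → ℂ) (ρ : Matrix (ι × E) (ι × E) ℂ) :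
    applyRow (c • f) ρ = ((‖c‖ ^ 2 : ℝ) : ℂ) • applyRow f ρ := by
  have : (rowMatrix E (c • f) : Matrix E (ι × E) ℂ) = c • rowMatrix E f := by
    ext e z
    simp [rowMatrix]
  rw [applyRow, applyRow, this, Matrix.conjTranspose_smul]
  simp only [Matrix.smul_mul, Matrix.mul_smul, smul_smul]
  rw [Complex.star_def, Complex.conj_mul']
  push_cast
  rfl

lemma rowMatrix_mulVec (f : ι → ℂ) (ψ : ι × E → ℂ) : rowMatrix E f *ᵥ ψ = contract f ψ := by
  ext e
  simp [Matrix.mulVec, dotProduct, rowMatrix, contract, Fintype.sum_prod_type]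

lemma applyRow_pureState (f : ι → ℂ) (ψ : ι × E → ℂ) :
    applyRow f (pureState ψ) = pureState (contract f ψ) := by
  rw [applyRow, pureState, Matrix.mul_vecMulVec, Matrix.vecMulVec_mul, rowMatrix_mulVec,
    ← Matrix.star_mulVec, rowMatrix_mulVec, pureState]

lemma traceLeft_eq_sum_applyRow [DecidableEq ι] (ρ : Matrix (ι × E) (ι × E) ℂ) :
    traceLeft ρ = ∑ i, applyRow (Pi.single i 1) ρ := by
  ext e e'
  simp only [traceLeft, Matrix.sum_apply]
  refine Finset.sum_congr rfl fun i _ => ?_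
  simp [applyRow, Matrix.mul_apply, rowMatrix, Fintype.sum_prod_type, Pi.single_apply,
    Matrix.conjTranspose_apply, Finset.sum_ite_eq, apply_ite]

lemma traceLeft_applyLeft [DecidableEq κ] (K : Matrix κ ι ℂ) (ρ : Matrix (ι × E) (ι × E) ℂ) :
    traceLeft (applyLeft K ρ) = ∑ j, applyRow (K j) ρ := by
  rw [traceLeft_eq_sum_applyRow]
  refine Finset.sum_congr rfl fun j _ => ?_
  rw [applyRow_applyLeft, Matrix.single_one_vecMul]
  rfl

/-- A subnormalised row vector extracts at most the partial trace. -/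
lemma posSemidef_traceLeft_sub_applyRow [DecidableEq ι] {f : ι → ℂ} (hf : nsq f ≤ 1)
    {ρ : Matrix (ι × E) (ι × E) ℂ} (hρ : ρ.PosSemidef) :
    (traceLeft ρ - applyRow f ρ).PosSemidef := by
  obtain ⟨n, v, rfl⟩ := Matrix.posSemidef_iff_eq_sum_vecMulVec.mp hρ
  have hsum : ∀ g : ι → ℂ, (applyRow g (∑ i, Matrix.vecMulVec (v i) (star (v i))) : Matrix E E ℂ)
      = ∑ i, applyRow g (pureState (v i)) := by
    intro g
    simp [applyRow, Matrix.mul_sum, Matrix.sum_mul, pureState]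
  rw [traceLeft_eq_sum_applyRow, hsum]
  simp only [hsum]
  rw [Finset.sum_comm, ← Finset.sum_sub_distrib]
  refine Matrix.posSemidef_sum _ fun k _ => ?_
  simp only [applyRow_pureState]
  refine Matrix.posSemidef_iff_dotProduct_mulVec.mpr ⟨?_, fun x => ?_⟩
  · refine Matrix.IsHermitian.sub ?_ (posSemidef_pureState _).1
    exact (Matrix.posSemidef_sum _ fun i _ => posSemidef_pureState _).1
  · set a : ι → ℂ := fun i => ∑ e, star (x e) * v k (i, e) with ha
    have hq : ∀ g : ι → ℂ, star x ⬝ᵥ (pureState (contract g (v k)) *ᵥ x)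
        = ((‖g ⬝ᵥ a‖ ^ 2 : ℝ) : ℂ) := by
      intro g
      have h1 : star x ⬝ᵥ contract g (v k) = g ⬝ᵥ a := by
        simp only [dotProduct, contract, ha, Finset.mul_sum, Pi.star_apply]
        rw [Finset.sum_comm]
        refine Finset.sum_congr rfl fun _ _ => Finset.sum_congr rfl fun _ _ => by ring
      have h2 : star (contract g (v k)) ⬝ᵥ x = star (g ⬝ᵥ a) := by
        rw [← h1, ← Matrix.star_dotProduct_star, star_star, dotProduct_comm]
      rw [pureState, Matrix.vecMulVec_mulVec, h2]
      simp only [dotProduct_smul, h1]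
      push_cast
      rw [← Complex.mul_conj']
      rfl
    rw [Matrix.sub_mulVec, dotProduct_sub, Matrix.sum_mulVec, dotProduct_sum]
    simp only [hq]
    rw [← Complex.ofReal_sum, ← Complex.ofReal_sub]
    have h3 : ∑ i, ‖(Pi.single i 1 : ι → ℂ) ⬝ᵥ a‖ ^ 2 = nsq a := by simp [nsq]
    have h4 := norm_dotProduct_sq_le f a
    have h5 : 0 ≤ nsq a - ‖f ⬝ᵥ a‖ ^ 2 := by nlinarith [nsq_nonneg a]
    rw [h3]
    exact_mod_cast h5

end Maps

/-! ### The recursive measurement -/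

section Measure

variable {k m : ℕ} {A : Type*} [Fintype A] [DecidableEq A]

/-- The part of the prepared state `U |0ⁿ⟩|a₀⟩` whose flag is not raised. -/
def flagFree (a₀ : A) (n : ℕ) (U : Matrix (Reg k m × A) (Reg k m × A) ℂ) : Reg k m → ℂ :=
  fun s => U (s, a₀) (enc k m (zeroBits n), a₀)

lemma measProj_false_apply (a₀ : A) (n : ℕ) (U : Matrix (Reg k m × A) (Reg k m × A) ℂ)
    (z z' : Reg k m × A) :
    measProj a₀ n U false z z' =
      U z (enc k m (zeroBits n), a₀) * star (U z' (enc k m (zeroBits n), a₀)) := by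
  simp [measProj, Matrix.mul_apply, Matrix.single_apply, Matrix.conjTranspose_apply, ite_and]

lemma measProj_true (a₀ : A) (n : ℕ) (U : Matrix (Reg k m × A) (Reg k m × A) ℂ) :
    measProj a₀ n U true = 1 - measProj a₀ n U false := rfl

lemma conjTranspose_measProj_mul_self {a₀ : A} {n : ℕ}
    {U : Matrix (Reg k m × A) (Reg k m × A) ℂ} (hU : Uᴴ * U = 1) (d : Bool) :
    (measProj a₀ n U d)ᴴ * measProj a₀ n U d = measProj a₀ n U d := by
  have h1 : (measProj a₀ n U false)ᴴ = measProj a₀ n U false := by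
    simp [measProj, Matrix.conjTranspose_mul, Matrix.mul_assoc]
  have h2 : measProj a₀ n U false * measProj a₀ n U false = measProj a₀ n U false := by
    simp only [measProj]
    calc _ = U * Matrix.single (enc k m (zeroBits n), a₀) (enc k m (zeroBits n), a₀) 1 *
          (Uᴴ * U) * Matrix.single (enc k m (zeroBits n), a₀) (enc k m (zeroBits n), a₀) 1 * Uᴴ := by
          simp only [Matrix.mul_assoc]
      _ = _ := by rw [hU, Matrix.mul_one, Matrix.mul_assoc U, Matrix.single_mul_single_same, mul_one]
  cases d with
  | false => rw [h1, h2]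
  | true =>
    rw [measProj_true, Matrix.conjTranspose_sub, h1, Matrix.conjTranspose_one]
    simp [Matrix.mul_sub, Matrix.sub_mul, h2]

lemma sum_norm_sq_col {ι : Type*} [Fintype ι] [DecidableEq ι] {U : Matrix ι ι ℂ}
    (hU : Uᴴ * U = 1) (j : ι) : nsq (fun i => U i j) = 1 := by
  have h1 := congrFun (congrFun hU j) j
  have h2 := ofReal_nsq fun i => U i j
  rw [Matrix.mul_apply, Matrix.one_apply_eq] at h1
  have : ((nsq fun i => U i j : ℝ) : ℂ) = 1 := by
    rw [h2, ← h1]; rfl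
  exact_mod_cast this

lemma nsq_flagFree_le {a₀ : A} {n : ℕ} {U : Matrix (Reg k m × A) (Reg k m × A) ℂ}
    (hU : Uᴴ * U = 1) : nsq (flagFree a₀ n U) ≤ 1 := by
  rw [← sum_norm_sq_col hU (enc k m (zeroBits n), a₀), nsq_prod]
  exact Finset.single_le_sum (f := fun a => nsq fun s => U (s, a) (enc k m (zeroBits n), a₀))
    (fun a _ => nsq_nonneg _) (Finset.mem_univ a₀)

variable {E : Type u} [Fintype E] [DecidableEq E]

/-- The Kraus operator `⟨a| Π_d |a₀⟩` of the two-outcome measurement. -/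
def measKraus (a₀ : A) (n : ℕ) (U : Matrix (Reg k m × A) (Reg k m × A) ℂ) (d : Bool) (a : A) :
    Matrix (Reg k m) (Reg k m) ℂ :=
  Matrix.of fun s s' => measProj a₀ n U d (s, a) (s', a₀)

lemma measStep_eq (a₀ : A) (n : ℕ) (U : Matrix (Reg k m × A) (Reg k m × A) ℂ) (d : Bool)
    (ρ : Matrix (Reg k m × E) (Reg k m × E) ℂ) :
    measStep a₀ n U d ρ = ∑ a, applyLeft (measKraus a₀ n U d a) ρ := rfl

lemma measStep_sub (a₀ : A) (n : ℕ) (U : Matrix (Reg k m × A) (Reg k m × A) ℂ) (d : Bool)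
    (ρ σ : Matrix (Reg k m × E) (Reg k m × E) ℂ) :
    measStep a₀ n U d (ρ - σ) = measStep a₀ n U d ρ - measStep a₀ n U d σ := by
  simp only [measStep_eq, applyLeft_sub, Finset.sum_sub_distrib]

lemma posSemidef_measStep (a₀ : A) (n : ℕ) (U : Matrix (Reg k m × A) (Reg k m × A) ℂ) (d : Bool)
    {ρ : Matrix (Reg k m × E) (Reg k m × E) ℂ} (hρ : ρ.PosSemidef) :
    (measStep a₀ n U d ρ).PosSemidef :=
  Matrix.posSemidef_sum _ fun _ _ => posSemidef_applyLeft _ hρ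

lemma trace_measStep (a₀ : A) (n : ℕ) {U : Matrix (Reg k m × A) (Reg k m × A) ℂ}
    (hU : Uᴴ * U = 1) (ρ : Matrix (Reg k m × E) (Reg k m × E) ℂ) :
    (measStep a₀ n U false ρ).trace + (measStep a₀ n U true ρ).trace = ρ.trace := by
  have hK : ∀ d, (measStep a₀ n U d ρ).trace =
      (((measProj a₀ n U d).submatrix (fun s => (s, a₀)) (fun s => (s, a₀)) ⊗ₖ
        (1 : Matrix E E ℂ)) * ρ).trace := by
    intro d
    simp only [measStep_eq, Matrix.trace_sum, trace_applyLeft]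
    rw [← Matrix.trace_sum, ← Finset.sum_mul]
    congr 2
    conv_rhs => rw [← conjTranspose_measProj_mul_self hU]
    ext ⟨s, e⟩ ⟨s', e'⟩
    simp only [Matrix.sum_apply, Matrix.kroneckerMap_apply, Matrix.submatrix_apply,
      Matrix.mul_apply, Matrix.conjTranspose_apply, Fintype.sum_prod_type, ← Finset.sum_mul,
      measKraus, Matrix.of_apply]
    rw [Finset.sum_comm]
  rw [hK, hK, ← Matrix.trace_add, ← Matrix.add_mul, ← Matrix.add_kronecker, measProj_true]
  congr 1
  have : ∀ M : Matrix (Reg k m × A) (Reg k m × A) ℂ,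
      M.submatrix (fun s => (s, a₀)) (fun s => (s, a₀)) +
      (1 - M).submatrix (fun s => (s, a₀)) (fun s => (s, a₀)) = (1 : Matrix (Reg k m) _ ℂ) := by
    intro M
    ext s s'
    simp [Matrix.one_apply]
  rw [this, Matrix.one_kronecker_one, Matrix.one_mul]

/-- The outcome zero extracts exactly the flag-free part of the prepared state: the flagged
components only complete the norm of the prepared state to one. -/
lemma traceLeft_measStep_false (a₀ : A) (n : ℕ) {U : Matrix (Reg k m × A) (Reg k m × A) ℂ}
    (hU : Uᴴ * U = 1) (ρ : Matrix (Reg k m × E) (Reg k m × E) ℂ) :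
    traceLeft (measStep a₀ n U false ρ) = applyRow (star (flagFree a₀ n U)) ρ := by
  have h1 : traceLeft (measStep a₀ n U false ρ) = ∑ a, ∑ s,
      ((‖U (s, a) (enc k m (zeroBits n), a₀)‖ ^ 2 : ℝ) : ℂ) •
        applyRow (star (flagFree a₀ n U)) ρ := by
    have : ∀ F : A → Matrix (Reg k m × E) (Reg k m × E) ℂ,
        traceLeft (∑ a, F a) = ∑ a, traceLeft (F a) := by
      intro F
      ext e e'
      simp only [traceLeft, Matrix.sum_apply]
      exact Finset.sum_comm
    rw [measStep_eq, this]
    refine Finset.sum_congr rfl fun a _ => ?_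
    rw [traceLeft_applyLeft]
    refine Finset.sum_congr rfl fun s _ => ?_
    rw [← applyRow_smul]
    congr 1
    ext s'
    exact measProj_false_apply _ _ _ _ _
  have h2 := sum_norm_sq_col hU (enc k m (zeroBits n), a₀)
  rw [nsq_prod] at h2
  rw [h1]
  simp only [← Finset.sum_smul, ← Complex.ofReal_sum]
  simp only [nsq] at h2
  rw [h2, Complex.ofReal_one, one_smul]

/-- On the outcome one, the branch in which the ancilla stays unflagged applies `I - |φ⟩⟨φ|`. -/
lemma posSemidef_measStep_true_sub (a₀ : A) (n : ℕ) (U : Matrix (Reg k m × A) (Reg k m × A) ℂ)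
    {ρ : Matrix (Reg k m × E) (Reg k m × E) ℂ} (hρ : ρ.PosSemidef) :
    (measStep a₀ n U true ρ - applyLeft (coproj (flagFree a₀ n U)) ρ).PosSemidef := by
  have h : coproj (flagFree a₀ n U) = measKraus a₀ n U true a₀ := by
    ext s s'
    rw [measKraus, Matrix.of_apply, measProj_true, Matrix.sub_apply, measProj_false_apply]
    simp [coproj, Matrix.vecMulVec_apply, flagFree, Matrix.one_apply]
  rw [measStep_eq, h, ← Finset.add_sum_erase _ _ (Finset.mem_univ a₀), add_sub_cancel_left]
  exact Matrix.posSemidef_sum _ fun _ _ => posSemidef_applyLeft _ hρ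

variable {a₀ : A} {U : ℕ → Matrix (Reg k m × A) (Reg k m × A) ℂ}
  {S : ℕ → Matrix (Reg k m × Reg k m) (Reg k m) ℂ}

/-- The register after a nonzero outcome is split; the second half joins the environment. -/
def splitRegister (S : Matrix (Reg k m × Reg k m) (Reg k m) ℂ)
    (ρ : Matrix (Reg k m × E) (Reg k m × E) ℂ) :
    Matrix (Reg k m × Reg k m × E) (Reg k m × Reg k m × E) ℂ :=
  Matrix.reindex (Equiv.prodAssoc _ _ _) (Equiv.prodAssoc _ _ _) (applyLeft S ρ)

lemma splitRegister_sub (S : Matrix (Reg k m × Reg k m) (Reg k m) ℂ)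
    (ρ σ : Matrix (Reg k m × E) (Reg k m × E) ℂ) :
    splitRegister S (ρ - σ) = splitRegister S ρ - splitRegister S σ := by
  rw [splitRegister, applyLeft_sub]
  rfl

lemma posSemidef_splitRegister (S : Matrix (Reg k m × Reg k m) (Reg k m) ℂ)
    {ρ : Matrix (Reg k m × E) (Reg k m × E) ℂ} (hρ : ρ.PosSemidef) :
    (splitRegister S ρ).PosSemidef :=
  (posSemidef_applyLeft S hρ).submatrix _

lemma trace_splitRegister {S : Matrix (Reg k m × Reg k m) (Reg k m) ℂ} (hS : Sᴴ * S = 1)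
    (ρ : Matrix (Reg k m × E) (Reg k m × E) ℂ) : (splitRegister S ρ).trace = ρ.trace := by
  have : (splitRegister S ρ).trace = (applyLeft S ρ).trace :=
    Equiv.sum_comp (Equiv.prodAssoc (Reg k m) (Reg k m) E).symm
      fun z => applyLeft S ρ z z
  rw [this, trace_applyLeft, hS, Matrix.one_kronecker_one, Matrix.one_mul]

lemma applyRow_applyRow_splitRegister (f g : Reg k m → ℂ)
    (S : Matrix (Reg k m × Reg k m) (Reg k m) ℂ) (ρ : Matrix (Reg k m × E) (Reg k m × E) ℂ) :
    applyRow g (applyRow f (splitRegister S ρ)) = applyRow (tensor f g ᵥ* S) ρ := by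
  rw [← applyRow_applyLeft]
  set σ := applyLeft S ρ with hσ
  have h : rowMatrix E g * rowMatrix (Reg k m × E) f =
      (rowMatrix E (tensor f g)).reindex (Equiv.refl _) (Equiv.prodAssoc _ _ _) := by
    ext e ⟨s, s', e'⟩
    simp [Matrix.mul_apply, rowMatrix, Fintype.sum_prod_type, tensor, Prod.ext_iff, ite_and,
      mul_comm]
  have h2 : applyRow g (applyRow f (splitRegister S ρ)) =
      (rowMatrix E g * rowMatrix (Reg k m × E) f) * splitRegister S ρ *
        (rowMatrix E g * rowMatrix (Reg k m × E) f)ᴴ := by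
    simp only [applyRow, Matrix.conjTranspose_mul, Matrix.mul_assoc]
  rw [h2, h, splitRegister, applyRow, Matrix.conjTranspose_reindex, ← hσ]
  simp [Matrix.reindex_apply, Matrix.submatrix_mul_equiv]

lemma measure_succ (q limit : ℕ) (ρ : Matrix (Reg k m × E) (Reg k m × E) ℂ)
    (b : Bits (2 ^ (q + 1))) : measure a₀ U S (q + 1) limit ρ b =
      if limit = 0 then (if b = zeroBits _ then traceLeft ρ else 0)
      else (if b = zeroBits _ then traceLeft (measStep a₀ (2 ^ (q + 1)) (U (q + 1)) false ρ) else 0)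
        + measure a₀ U S q (limit - wt (firstHalf b))
          (measure a₀ U S q limit
            (splitRegister (S q) (measStep a₀ (2 ^ (q + 1)) (U (q + 1)) true ρ)) (firstHalf b))
          (secondHalf b) := rfl

lemma measure_sub (q limit : ℕ) {E : Type u} [Fintype E] [DecidableEq E]
    (ρ σ : Matrix (Reg k m × E) (Reg k m × E) ℂ) (b : Bits (2 ^ q)) :
    measure a₀ U S q limit (ρ - σ) b = measure a₀ U S q limit ρ b - measure a₀ U S q limit σ b := by
  induction q generalizing limit E with
  | zero =>
    simp only [measure]
    split_ifs <;> simp [traceLeft_sub, measStep_sub]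
  | succ q ih =>
    simp only [measure_succ]
    rw [measStep_sub, measStep_sub, splitRegister_sub, ih, ih, traceLeft_sub, traceLeft_sub]
    split_ifs <;> first | rfl | abel

lemma posSemidef_measure (q limit : ℕ) {E : Type u} [Fintype E] [DecidableEq E]
    {ρ : Matrix (Reg k m × E) (Reg k m × E) ℂ} (hρ : ρ.PosSemidef) (b : Bits (2 ^ q)) :
    (measure a₀ U S q limit ρ b).PosSemidef := by
  induction q generalizing limit E with
  | zero =>
    simp only [measure]
    split_ifs
    · exact posSemidef_traceLeft hρ
    · exact Matrix.PosSemidef.zero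
    · exact posSemidef_traceLeft (posSemidef_measStep _ _ _ _ hρ)
  | succ q ih =>
    have h := ih (limit - wt (firstHalf b)) (ih limit (posSemidef_splitRegister (S q)
      (posSemidef_measStep a₀ (2 ^ (q + 1)) (U (q + 1)) true hρ)) (firstHalf b)) (secondHalf b)
    rw [measure_succ]
    split_ifs
    · exact posSemidef_traceLeft hρ
    · exact Matrix.PosSemidef.zero
    · exact (posSemidef_traceLeft (posSemidef_measStep _ _ _ _ hρ)).add h
    · exact Matrix.PosSemidef.zero.add h

lemma sum_trace_measure {p q : ℕ} (hU : ∀ q ≤ p, (U q)ᴴ * U q = 1)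
    (hS : ∀ q < p, (S q)ᴴ * S q = 1) (hq : q ≤ p) (limit : ℕ)
    {E : Type u} [Fintype E] [DecidableEq E] (ρ : Matrix (Reg k m × E) (Reg k m × E) ℂ) :
    ∑ b, (measure a₀ U S q limit ρ b).trace = ρ.trace := by
  induction q generalizing limit E with
  | zero =>
    rcases Nat.eq_zero_or_pos limit with rfl | h
    · simp only [measure, if_true]
      rw [Finset.sum_eq_single (zeroBits (2 ^ 0))
        (fun b _ hb => by rw [if_neg hb, Matrix.trace_zero]) (by simp), if_pos rfl, trace_traceLeft]
    · simp only [measure, h.ne', if_false, trace_traceLeft]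
      rw [sum_bits_one]
      exact trace_measStep a₀ 1 (hU 0 hq) ρ
  | succ q ih =>
    have hq' : q ≤ p := by omega
    simp only [measure_succ]
    rcases Nat.eq_zero_or_pos limit with rfl | h
    · simp only [if_true]
      rw [Finset.sum_eq_single (zeroBits _) (by intro b _ hb; simp [hb]) (by simp), if_pos rfl,
        trace_traceLeft]
    · simp only [h.ne', if_false, Matrix.trace_add, Finset.sum_add_distrib]
      rw [Finset.sum_eq_single (zeroBits _) (by intro b _ hb; simp [hb]) (by simp), if_pos rfl,
        trace_traceLeft, sum_bits_succ _ (fun b₁ b₂ => (measure a₀ U S q (limit - wt b₁)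
          (measure a₀ U S q limit (splitRegister (S q)
            (measStep a₀ (2 ^ (q + 1)) (U (q + 1)) true ρ)) b₁) b₂).trace) fun b => rfl]
      simp only [ih hq']
      rw [trace_splitRegister (hS q (by omega)), trace_measStep a₀ _ (hU (q + 1) hq)]

/-- The Kraus row vectors of the recursive measurement in the branch in which no flag is raised,
every block with a nonzero outcome turns out to contain a one, and a register that encodes a single
one is found along `θ` when it is discarded. -/
abbrev registerRow (a₀ : A) (U : ℕ → Matrix (Reg k m × A) (Reg k m × A) ℂ)
    (S : ℕ → Matrix (Reg k m × Reg k m) (Reg k m) ℂ) (θ : Reg k m → ℂ) (q : ℕ) (b : Bits (2 ^ q)) :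
    Reg k m → ℂ :=
  treeRow (Z := fun _ => Reg k m) (fun q => flagFree a₀ (2 ^ q) (U q)) θ S q b

/-- Before the limit is reached, the recursive measurement contains the branch that
`registerRow` describes. -/
lemma posSemidef_measure_sub_applyRow {p q : ℕ} (hU : ∀ q ≤ p, (U q)ᴴ * U q = 1)
    {θ : Reg k m → ℂ} (hθ : nsq θ ≤ 1) (hq : q ≤ p) {limit : ℕ}
    {E : Type u} [Fintype E] [DecidableEq E] {ρ : Matrix (Reg k m × E) (Reg k m × E) ℂ}
    (hρ : ρ.PosSemidef) {b : Bits (2 ^ q)} (hb : wt b < limit) :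
    (measure a₀ U S q limit ρ b - applyRow (registerRow a₀ U S θ q b) ρ).PosSemidef := by
  induction q generalizing limit E with
  | zero =>
    have hl : limit ≠ 0 := by omega
    simp only [measure, if_neg hl, registerRow, treeRow]
    by_cases h : b 0 = true
    · rw [if_pos h, h]
      rw [← applyRow_applyLeft]
      have h1 := posSemidef_traceLeft (posSemidef_measStep_true_sub a₀ 1 (U 0) hρ)
      rw [traceLeft_sub] at h1
      have h2 := posSemidef_traceLeft_sub_applyRow hθ
        (posSemidef_applyLeft (coproj (flagFree a₀ 1 (U 0))) hρ)
      have h3 := h1.add h2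
      rwa [sub_add_sub_cancel] at h3
    · rw [if_neg h, Bool.not_eq_true _ |>.mp h, traceLeft_measStep_false a₀ 1 (hU 0 hq)]
      simpa using Matrix.PosSemidef.zero
  | succ q ih =>
    have hl : limit ≠ 0 := by omega
    have hq' : q ≤ p := by omega
    rw [measure_succ, if_neg hl]
    set σ := splitRegister (S q) (measStep a₀ (2 ^ (q + 1)) (U (q + 1)) true ρ) with hσ
    have hσ0 : σ.PosSemidef := posSemidef_splitRegister (S q) (posSemidef_measStep _ _ _ _ hρ)
    by_cases h : b = zeroBits _
    · rw [if_pos h, h, registerRow, treeRow_zeroBits, traceLeft_measStep_false a₀ _ (hU _ hq),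
        add_sub_cancel_left]
      exact posSemidef_measure _ _ (posSemidef_measure _ _ hσ0 _) _
    · rw [if_neg h, zero_add, registerRow, treeRow, if_neg h, ← Matrix.vecMul_vecMul,
        ← applyRow_applyLeft, ← applyRow_applyRow_splitRegister]
      have hw := wt_halves b
      set K := applyLeft (coproj (flagFree a₀ (2 ^ (q + 1)) (U (q + 1)))) ρ with hK
      set f := registerRow a₀ U S θ q with hf
      set l := limit - wt (firstHalf b) with hl'
      have h1 : (σ - splitRegister (S q) K).PosSemidef := by
        rw [hσ, ← splitRegister_sub]
        exact posSemidef_splitRegister _ (posSemidef_measStep_true_sub _ _ _ hρ)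
      have h2 := (ih hq' hσ0 (b := firstHalf b) (limit := limit) (by omega)).add
        (posSemidef_applyRow (f (firstHalf b)) h1)
      rw [applyRow_sub, sub_add_sub_cancel] at h2
      have h3 := posSemidef_measure (a₀ := a₀) (U := U) (S := S) q l h2 (secondHalf b)
      rw [measure_sub] at h3
      have h4 := ih hq' (posSemidef_applyRow (f (firstHalf b))
        (posSemidef_splitRegister (S q) (posSemidef_applyLeft
          (coproj (flagFree a₀ (2 ^ (q + 1)) (U (q + 1)))) hρ))) (b := secondHalf b)
          (limit := l) (by omega)
      have h5 := h3.add h4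
      rwa [sub_add_sub_cancel] at h5

end Measure

/-! ### The succinct encoding -/

lemma length_gaps (c : ℕ) (l : List Bool) : (gaps c l).length = l.count true := by
  induction l generalizing c with
  | nil => rfl
  | cons a l ih => cases a <;> simp [gaps, ih]

lemma le_of_gaps_eq_cons {c g : ℕ} {l : List Bool} {t : List ℕ} (h : gaps c l = g :: t) :
    c ≤ g := by
  induction l generalizing c with
  | nil => simp [gaps] at h
  | cons a l ih =>
    cases a with
    | false => exact (Nat.le_succ c).trans (ih h)
    | true => simp only [gaps, List.cons.injEq] at h; exact h.1.le

lemma lt_of_mem_gaps {c g : ℕ} {l : List Bool} (h : g ∈ gaps c l) : g < c + l.length := by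
  induction l generalizing c with
  | nil => simp [gaps] at h
  | cons a l ih =>
    rw [List.length_cons]
    cases a with
    | false => have := ih h; omega
    | true =>
      rcases List.mem_cons.mp h with rfl | h
      · omega
      · have := ih h; omega

lemma eq_of_gaps_eq {c : ℕ} {l l' : List Bool} (hlen : l.length = l'.length)
    (h : gaps c l = gaps c l') : l = l' := by
  induction l generalizing c l' with
  | nil => exact (List.length_eq_zero_iff.mp hlen.symm).symm
  | cons a l ih =>
    cases l' with
    | nil => simp at hlen
    | cons a' l' =>
      have hlen' : l.length = l'.length := by simpa using hlen
      cases a <;> cases a' <;> simp only [gaps] at h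
      · rw [ih hlen' h]
      · have := le_of_gaps_eq_cons h; omega
      · have := le_of_gaps_eq_cons h.symm; omega
      · rw [ih hlen' (List.cons.inj h).2]

lemma length_gaps_ofFn {n : ℕ} (x : Bits n) : (gaps 0 (List.ofFn x)).length = wt x := by
  rw [length_gaps]
  induction n with
  | zero => simp [wt]
  | succ n ih =>
    rw [List.ofFn_succ, List.count_cons, ih, wt_eq_sum, wt_eq_sum, Fin.sum_univ_succ, add_comm]
    cases x 0 <;> simp

lemma enc_val {k m n : ℕ} (hn : n ≤ m) (x : Bits n) (i : Fin (k + 1)) :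
    (enc k m x i).val = (gaps 0 (List.ofFn x)).getD i.1 n := by
  have : (gaps 0 (List.ofFn x)).getD i.1 n ≤ n := by
    rw [List.getD_eq_getElem?_getD]
    rcases lt_or_ge i.1 (gaps 0 (List.ofFn x)).length with h | h
    · rw [List.getElem?_eq_getElem h, Option.getD_some]
      have := lt_of_mem_gaps (List.getElem_mem h)
      simpa using this.le
    · rw [List.getElem?_eq_none h, Option.getD_none]
  rw [enc, Fin.val_ofNat, Nat.mod_eq_of_lt (by omega)]

lemma enc_val_of_lt {k m n : ℕ} (hn : n ≤ m) (x : Bits n) {i : Fin (k + 1)} (hi : i.1 < wt x) :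
    (enc k m x i).val < n := by
  rw [← length_gaps_ofFn] at hi
  rw [enc_val hn, List.getD_eq_getElem _ _ hi]
  simpa using lt_of_mem_gaps (List.getElem_mem hi)

lemma enc_val_of_ge {k m n : ℕ} (hn : n ≤ m) (x : Bits n) {i : Fin (k + 1)} (hi : wt x ≤ i.1) :
    (enc k m x i).val = n := by
  rw [← length_gaps_ofFn] at hi
  rw [enc_val hn, List.getD_eq_default _ _ hi]

/-- The register determines every string with at most `k + 1` ones. -/
lemma enc_injOn {k m n : ℕ} (hn : n ≤ m) {x y : Bits n} (hx : wt x ≤ k + 1) (hy : wt y ≤ k + 1)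
    (h : enc k m x = enc k m y) : x = y := by
  have hwt : wt x = wt y := by
    rcases lt_trichotomy (wt x) (wt y) with hlt | heq | hlt
    · have h1 := enc_val_of_ge (k := k) (i := ⟨wt x, by omega⟩) hn x le_rfl
      have h2 := enc_val_of_lt (k := k) (i := ⟨wt x, by omega⟩) hn y hlt
      rw [← h] at h2
      omega
    · exact heq
    · have h1 := enc_val_of_ge (k := k) (i := ⟨wt y, by omega⟩) hn y le_rfl
      have h2 := enc_val_of_lt (k := k) (i := ⟨wt y, by omega⟩) hn x hlt
      rw [h] at h2
      omega
  refine List.ofFn_injective (eq_of_gaps_eq (c := 0) (by simp) ?_)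
  refine List.ext_getElem (by rw [length_gaps_ofFn, length_gaps_ofFn, hwt]) fun i h1 h2 => ?_
  have hi : i < k + 1 := by rw [length_gaps_ofFn] at h1; omega
  have h3 := congrArg Fin.val (congrFun h ⟨i, hi⟩)
  rw [enc_val hn, enc_val hn, List.getD_eq_getElem _ _ h1, List.getD_eq_getElem _ _ h2] at h3
  exact h3

lemma card_enc_ne_last {k m : ℕ} {x : Bits m} (hx : wt x ≤ k) :
    (Finset.univ.filter fun i => enc k m x i ≠ Fin.last m).card = wt x := by
  have : (Finset.univ.filter fun i => enc k m x i ≠ Fin.last m) =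
      Finset.univ.filter fun i : Fin (k + 1) => i.1 < wt x := by
    ext i
    simp only [Finset.mem_filter, Finset.mem_univ, true_and, ne_eq, Fin.ext_iff, Fin.val_last]
    constructor
    · intro h
      by_contra h'
      exact h (enc_val_of_ge le_rfl x (not_lt.mp h'))
    · intro h
      exact (enc_val_of_lt le_rfl x h).ne
  rw [this, Fin.card_filter_val_lt]
  omega

/-! ### Basis embeddings -/

section Embeddings

variable {ι κ μ : Type*} [Fintype ι] [Fintype κ] [Fintype μ] [DecidableEq ι] [DecidableEq κ]
  [DecidableEq μ]

/-- The matrix that maps the basis vector `i` to the basis vector `f i`. -/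
def basisMap (f : ι → κ) : Matrix κ ι ℂ := Matrix.of fun j i => if j = f i then 1 else 0

lemma mul_basisMap (S : Matrix μ κ ℂ) (f : ι → κ) (z : μ) (i : ι) :
    (S * basisMap f) z i = S z (f i) := by
  simp [Matrix.mul_apply, basisMap]

lemma basisMap_mul (f : κ → μ) (g : ι → κ) : basisMap f * basisMap g = basisMap (f ∘ g) := by
  ext z i
  rw [mul_basisMap]
  rfl

lemma basisMap_kronecker {ι' κ' : Type*} [DecidableEq κ'] (f : ι → κ) (g : ι' → κ') :
    basisMap f ⊗ₖ basisMap g = basisMap (Prod.map f g) := by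
  ext ⟨a, b⟩ ⟨c, d⟩
  simp only [basisMap, Matrix.kroneckerMap_apply, Matrix.of_apply, Prod.map_apply, Prod.mk.injEq]
  split_ifs <;> simp_all

lemma basisMap_isometry {f : ι → κ} (hf : Function.Injective f) :
    (basisMap f)ᴴ * basisMap f = 1 := by
  ext i j
  rw [mul_basisMap]
  simp [Matrix.conjTranspose_apply, basisMap, Matrix.one_apply, hf.eq_iff, eq_comm, apply_ite]

lemma basisMap_mulVec_apply {f : ι → κ} (hf : Function.Injective f) (x : ι → ℂ) (i : ι) :
    (basisMap f *ᵥ x) (f i) = x i := by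
  simp [Matrix.mulVec, dotProduct, basisMap, hf.eq_iff]

lemma basisMap_mulVec_vecMul {f : ι → κ} (hf : Function.Injective f) (x : ι → ℂ) :
    (basisMap f *ᵥ x) ᵥ* basisMap f = x := by
  ext i
  rw [← basisMap_mulVec_apply hf x i]
  simp [Matrix.vecMul, dotProduct, basisMap]

end Embeddings

/-! ### The rotation `R^{⊗ n}` -/

section Rotation

variable {α β : ℝ}

lemma sum_prod_bits {M : Type*} [CommSemiring M] {n : ℕ} (F : Fin n → Bool → M) :
    ∑ x : Bits n, ∏ i, F i (x i) = ∏ i, (F i false + F i true) := by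
  have := Finset.prod_univ_sum (fun _ : Fin n => (Finset.univ : Finset Bool)) F
  simp only [Fintype.piFinset_univ, Fintype.sum_bool] at this
  rw [← this]
  exact Finset.prod_congr rfl fun _ _ => add_comm _ _

lemma prod_bits_ite {M : Type*} [CommMonoid M] {n : ℕ} (x : Bits n) (a b : M) :
    ∏ i, (if x i = true then a else b) = a ^ wt x * b ^ (n - wt x) := by
  have h : (Finset.univ.filter fun i => ¬ x i = true).card = n - wt x := by
    have := Finset.card_filter_add_card_filter_not (s := Finset.univ) (fun i => x i = true)
    rw [Finset.card_univ, Fintype.card_fin] at this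
    rw [wt]
    omega
  rw [Finset.prod_ite, Finset.prod_const, Finset.prod_const, h, wt]

lemma star_gateRPow (n : ℕ) (y x : Bits n) : star (gateRPow α β n y x) = gateRPow α β n y x := by
  have : ∀ a b, star (gateR α β a b) = gateR α β a b := by
    intro a b
    cases a <;> cases b <;> simp [gateR]
  rw [gateRPow, star_prod]
  exact Finset.prod_congr rfl fun _ _ => this _ _

lemma gateRPow_comm (n : ℕ) (y x : Bits n) : gateRPow α β n y x = gateRPow α β n x y := by
  refine Finset.prod_congr rfl fun i _ => ?_
  cases y i <;> cases x i <;> rfl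

lemma gateRPow_mul_self (h : α ^ 2 + β ^ 2 = 1) (n : ℕ) :
    gateRPow α β n * gateRPow α β n = 1 := by
  have hc : (α : ℂ) ^ 2 + (β : ℂ) ^ 2 = 1 := by exact_mod_cast h
  have hR : ∀ a b, gateR α β a false * gateR α β false b + gateR α β a true * gateR α β true b
      = if a = b then 1 else 0 := by
    intro a b
    cases a <;> cases b <;> simp [gateR] <;> first | linear_combination hc | ring
  ext y x
  simp only [Matrix.mul_apply, gateRPow, ← Finset.prod_mul_distrib]
  rw [sum_prod_bits fun i c => gateR α β (y i) c * gateR α β c (x i)]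
  simp only [hR, Matrix.one_apply]
  split_ifs with hyx
  · simp [hyx]
  · obtain ⟨i, hi⟩ := Function.ne_iff.mp hyx
    exact Finset.prod_eq_zero (Finset.mem_univ i) (if_neg hi)

lemma gateRPow_isometry (h : α ^ 2 + β ^ 2 = 1) (n : ℕ) :
    (gateRPow α β n)ᴴ * gateRPow α β n = 1 := by
  have : (gateRPow α β n)ᴴ = gateRPow α β n := by
    ext y x
    rw [Matrix.conjTranspose_apply, star_gateRPow, gateRPow_comm]
  rw [this, gateRPow_mul_self h]

lemma gateRPow_halves {q : ℕ} (b x : Bits (2 ^ (q + 1))) :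
    gateRPow α β _ b x = gateRPow α β _ (firstHalf b) (firstHalf x) *
      gateRPow α β _ (secondHalf b) (secondHalf x) :=
  prod_halves fun i => gateR α β (b i) (x i)

lemma gateRPow_zero (n : ℕ) (x : Bits n) :
    gateRPow α β n x (zeroBits n) = ((α ^ (n - wt x) * β ^ wt x : ℝ) : ℂ) := by
  have : gateRPow α β n x (zeroBits n) = ∏ i, (if x i = true then (β : ℂ) else α) := by
    refine Finset.prod_congr rfl fun i _ => ?_
    cases h : x i <;> simp [zeroBits, gateR]
  rw [this, prod_bits_ite]
  push_cast
  ring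

lemma le_one_of_sq_add_sq (h : α ^ 2 + β ^ 2 = 1) : α ≤ 1 := by nlinarith [sq_nonneg β]

lemma norm_gateRPow_zero_sq_le (hα : 0 ≤ α) (hβ : 0 ≤ β) (h : α ^ 2 + β ^ 2 = 1) {n : ℕ}
    (x : Bits n) : ‖gateRPow α β n x (zeroBits n)‖ ^ 2 ≤ (β ^ 2) ^ wt x := by
  rw [gateRPow_zero, Complex.norm_real, Real.norm_of_nonneg (by positivity), ← pow_mul, mul_comm 2,
    pow_mul]
  have h1 : α ^ (n - wt x) ≤ 1 := pow_le_one₀ hα (le_one_of_sq_add_sq h)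
  gcongr
  exact mul_le_of_le_one_left (by positivity) h1

lemma sum_norm_gateRPow_mul (hα : 0 ≤ α) (hβ : 0 ≤ β) (h : α ^ 2 + β ^ 2 = 1) {n : ℕ}
    (b : Bits n) :
    ∑ x, ‖gateRPow α β n b x‖ * ‖gateRPow α β n x (zeroBits n)‖ = (2 * α * β) ^ wt b := by
  simp only [gateRPow, norm_prod, ← Finset.prod_mul_distrib]
  rw [sum_prod_bits fun i c => ‖gateR α β (b i) c‖ * ‖gateR α β c (zeroBits n i)‖]
  have : ∀ i, ‖gateR α β (b i) false‖ * ‖gateR α β false (zeroBits n i)‖ +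
      ‖gateR α β (b i) true‖ * ‖gateR α β true (zeroBits n i)‖ =
      if b i = true then 2 * α * β else 1 := by
    intro i
    cases b i <;> simp [gateR, zeroBits, abs_of_nonneg, hα, hβ] <;> nlinarith
  simp only [this, prod_bits_ite, one_pow, mul_one]

end Rotation

/-! ### Tail bound -/

lemma sum_pow_wt (n : ℕ) (t : ℝ) : ∑ x : Bits n, t ^ wt x = (1 + t) ^ n := by
  have h := sum_prod_bits (n := n) fun _ c => if c = true then t else 1
  simp only [prod_bits_ite, one_pow, mul_one] at h
  simpa using h

lemma one_lt_logb {δ : ℝ} (h0 : 0 < δ) (h1 : δ < 1 / 2) : 1 < Real.logb 2 (1 / δ) := by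
  rw [Real.lt_logb_iff_rpow_lt (by norm_num) (by positivity), Real.rpow_one,
    lt_div_iff₀ h0]
  linarith

lemma cutoff_pos {δ : ℝ} (h0 : 0 < δ) (h1 : δ < 1 / 2) : 0 < cutoff δ := by
  have h := one_lt_logb h0 h1
  exact div_pos (by linarith) (Real.logb_pos (by norm_num) h)

/-- Chernoff bound with the weight `L = log₂ (1 / δ)` for each one: the weight of the strings with
at least `j` ones is at most `exp (K L) / L ^ j`, and `L ^ j ≥ 2 ^ (c L)` for `j ≥ c L / log₂ L`. -/
lemma sum_pow_wt_tail_le {K y δ : ℝ} {n j : ℕ} (hy : 0 ≤ y) (hn : n * y ≤ K) (h0 : 0 < δ)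
    (h1 : δ < 1 / 2) (hj : (K / Real.log 2 + 2) * cutoff δ ≤ j) :
    ∑ b : Bits n with j ≤ wt b, y ^ wt b ≤ δ ^ 2 := by
  set L := Real.logb 2 (1 / δ) with hL
  have hL1 : 1 < L := one_lt_logb h0 h1
  have hL0 : 0 < L := by linarith
  have hlog2 : 0 < Real.log 2 := Real.log_pos (by norm_num)
  have hlogL : 0 < Real.log L := Real.log_pos hL1
  have hLlog : L * Real.log 2 = -Real.log δ := by
    rw [hL, Real.logb, div_mul_cancel₀ _ hlog2.ne', one_div, Real.log_inv]
  have hpow : Real.exp ((K + 2 * Real.log 2) * L) ≤ L ^ j := by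
    rw [← Real.exp_log (pow_pos hL0 j), Real.log_pow]
    refine Real.exp_le_exp.mpr ?_
    have h2 : (K / Real.log 2 + 2) * cutoff δ * Real.log L = (K + 2 * Real.log 2) * L := by
      rw [cutoff, ← hL, Real.logb]
      field_simp
    rw [← h2]
    gcongr
  calc ∑ b : Bits n with j ≤ wt b, y ^ wt b
      ≤ ∑ b : Bits n with j ≤ wt b, (y * L) ^ wt b / L ^ j := by
        refine Finset.sum_le_sum fun b hb => ?_
        have hb : j ≤ wt b := by simpa using hb
        rw [le_div_iff₀ (by positivity), mul_pow]
        gcongr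
        exact hL1.le
    _ ≤ ∑ b : Bits n, (y * L) ^ wt b / L ^ j :=
        Finset.sum_le_sum_of_subset_of_nonneg (Finset.subset_univ _) fun _ _ _ => by positivity
    _ = (1 + y * L) ^ n / L ^ j := by rw [← Finset.sum_div, sum_pow_wt]
    _ ≤ Real.exp (K * L) / Real.exp ((K + 2 * Real.log 2) * L) := by
        gcongr
        calc (1 + y * L) ^ n ≤ Real.exp (y * L) ^ n := by
              gcongr
              linarith [Real.add_one_le_exp (y * L)]
          _ = Real.exp (n * y * L) := by rw [← Real.exp_nat_mul]; ring_nf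
          _ ≤ Real.exp (K * L) := by gcongr
    _ = δ ^ 2 := by
        rw [← Real.exp_sub]
        have : K * L - (K + 2 * Real.log 2) * L = Real.log (δ ^ 2) := by
          rw [Real.log_pow]; push_cast; linarith
        rw [this, Real.exp_log (by positivity)]

/-! ### The uncompressed measurement and its truncation as trees -/

section BitTrees

variable {α β : ℝ}

/-- The control state `R^{⊗ n} |0ⁿ⟩`. -/
def prepVec (α β : ℝ) (n : ℕ) : Bits n → ℂ := fun x => gateRPow α β n x (zeroBits n)

lemma nsq_prepVec (h : α ^ 2 + β ^ 2 = 1) (n : ℕ) : nsq (prepVec α β n) = 1 :=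
  sum_norm_sq_col (gateRPow_isometry h n) _

lemma prepVec_eq (n : ℕ) (x : Bits n) :
    prepVec α β n x = ((α ^ (n - wt x) * β ^ wt x : ℝ) : ℂ) := gateRPow_zero n x

lemma halves_injective (q : ℕ) : Function.Injective (halves q) := (halves q).injective

/-- The tree of the uncompressed measurement has the rows of `R^{⊗ n}` as Kraus vectors. -/
lemma treeRow_bits (h : α ^ 2 + β ^ 2 = 1) (q : ℕ) (b : Bits (2 ^ q)) :
    treeRow (Z := fun q => Bits (2 ^ q)) (fun q => prepVec α β (2 ^ q))
      (gateRPow α β (2 ^ 0) fun _ => true) (fun q => basisMap (halves q)) q b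
      = gateRPow α β (2 ^ q) b := by
  have hzero : ∀ n, star (prepVec α β n) = gateRPow α β n (zeroBits n) := by
    intro n
    ext x
    rw [Pi.star_apply, prepVec, star_gateRPow, gateRPow_comm]
  -- rows of `R^{⊗ n}` other than the first annihilate the prepared state
  have hcop : ∀ n (b : Bits n), b ≠ zeroBits n →
      gateRPow α β n b ᵥ* coproj (prepVec α β n) = gateRPow α β n b := by
    intro n b hb
    have h0 : gateRPow α β n b ⬝ᵥ prepVec α β n = 0 := by
      have := congrFun (congrFun (gateRPow_mul_self h n) b) (zeroBits n)
      rwa [Matrix.one_apply_ne hb] at this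
    rw [coproj, Matrix.vecMul_sub, Matrix.vecMul_one, Matrix.vecMul_vecMulVec, h0, zero_smul,
      sub_zero]
  induction q with
  | zero =>
    simp only [treeRow]
    split_ifs with hb
    · have : b = fun _ => true := by
        ext i
        rw [← hb]
        exact congrArg b (Subsingleton.elim (α := Fin 1) i 0)
      rw [this]
      exact hcop 1 _ fun h' => by simpa [zeroBits] using congrFun h' 0
    · have : b = zeroBits _ := by
        ext i
        rw [zeroBits, ← Bool.not_eq_true _ |>.mp hb]
        exact congrArg b (Subsingleton.elim (α := Fin 1) i 0)
      rw [this, ← hzero]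
  | succ q ih =>
    rw [treeRow, ih, ih]
    split_ifs with hb
    · rw [hzero, hb]
    · rw [← Matrix.vecMul_vecMul]
      have : tensor (gateRPow α β (2 ^ q) (firstHalf b)) (gateRPow α β (2 ^ q) (secondHalf b)) ᵥ*
          basisMap (halves q) = gateRPow α β (2 ^ (q + 1)) b := by
        ext x
        rw [gateRPow_halves]
        simp [Matrix.vecMul, dotProduct, basisMap, tensor, halves_apply]
      rw [this, hcop _ _ hb]

/-- Strings with at most `k` ones. -/
abbrev LowBits (k n : ℕ) := {x : Bits n // wt x ≤ k}

/-- The halves of a string with at most `k` ones. -/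
def lowHalves (k q : ℕ) (x : LowBits k (2 ^ (q + 1))) : LowBits k (2 ^ q) × LowBits k (2 ^ q) :=
  (⟨firstHalf x.1, by have := wt_halves x.1; have := x.2; omega⟩,
    ⟨secondHalf x.1, by have := wt_halves x.1; have := x.2; omega⟩)

lemma lowHalves_injective (k q : ℕ) : Function.Injective (lowHalves k q) := by
  intro x y h
  refine Subtype.ext (halves_injective q ?_)
  rw [halves_apply, halves_apply]
  exact Prod.ext (congrArg (fun z => z.1.1) h) (congrArg (fun z => z.2.1) h)

lemma nsq_comp_val_le {ι : Type*} [Fintype ι] (P : ι → Prop) [DecidablePred P] (x : ι → ℂ) :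
    nsq (fun i : {i // P i} => x i.1) ≤ nsq x := by
  have : nsq (fun i : {i // P i} => x i.1) = ∑ i with P i, ‖x i‖ ^ 2 :=
    (Finset.sum_subtype _ (by simp) fun i => ‖x i‖ ^ 2).symm
  rw [this]
  exact Finset.sum_le_sum_of_subset_of_nonneg (Finset.subset_univ _) fun _ _ _ => by positivity

lemma isTree_bits (h : α ^ 2 + β ^ 2 = 1) (p : ℕ) :
    IsTree (Z := fun q => Bits (2 ^ q)) p (fun q => prepVec α β (2 ^ q))
      (gateRPow α β (2 ^ 0) fun _ => true) (fun q => basisMap (halves q)) where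
  prep q _ := (nsq_prepVec h _).le
  leaf := by
    have h1 := sum_norm_sq_col (gateRPow_isometry h (2 ^ 0)) fun _ => true
    rw [← h1]
    refine le_of_eq (congrArg nsq ?_)
    ext x
    exact gateRPow_comm _ _ _
  split q _ := basisMap_isometry (halves_injective q)

lemma isTree_lowBits (h : α ^ 2 + β ^ 2 = 1) (p k : ℕ) :
    IsTree (Z := fun q => LowBits k (2 ^ q)) p (fun q x => prepVec α β (2 ^ q) x.1)
      (fun x => gateRPow α β (2 ^ 0) (fun _ => true) x.1)
      (fun q => basisMap (lowHalves k q)) where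
  prep q hq := (nsq_comp_val_le _ _).trans ((isTree_bits h p).prep q hq)
  leaf := (nsq_comp_val_le _ _).trans (isTree_bits h p).leaf
  split q _ := basisMap_isometry (lowHalves_injective k q)

lemma basisMap_val_mulVec_apply {ι : Type*} [Fintype ι] [DecidableEq ι] (P : ι → Prop)
    [DecidablePred P] (x : {i // P i} → ℂ) (i : ι) :
    (basisMap (Subtype.val : {i // P i} → ι) *ᵥ x) i = if h : P i then x ⟨i, h⟩ else 0 := by
  split_ifs with h
  · exact basisMap_mulVec_apply Subtype.val_injective x ⟨i, h⟩
  · refine Finset.sum_eq_zero fun j _ => ?_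
    have : i ≠ j.1 := fun e => h (e ▸ j.2)
    simp [basisMap, this]

/-- Truncation at `k` ones perturbs the uncompressed tree by the tail of the prepared states. -/
lemma isApproxEmbedding_bits (hα : 0 ≤ α) (hβ : 0 ≤ β) (h : α ^ 2 + β ^ 2 = 1) {p k : ℕ} {d : ℝ}
    (htail : ∀ q ≤ p, ∑ x : Bits (2 ^ q) with k ≤ wt x, (β ^ 2) ^ wt x ≤ d ^ 2) :
    IsApproxEmbedding (Z := fun q => Bits (2 ^ q)) (Y := fun q => LowBits k (2 ^ q)) p d
      (fun _ => basisMap Subtype.val)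
      (fun q => prepVec α β (2 ^ q)) (gateRPow α β (2 ^ 0) fun _ => true)
      (fun q => basisMap (halves q))
      (fun q x => prepVec α β (2 ^ q) x.1) (fun x => gateRPow α β (2 ^ 0) (fun _ => true) x.1)
      (fun q => basisMap (lowHalves k q)) where
  isometry q _ := basisMap_isometry Subtype.val_injective
  prep q hq := by
    refine le_trans ?_ (htail q hq)
    rw [Finset.sum_filter]
    refine Finset.sum_le_sum fun x _ => ?_
    rw [Pi.sub_apply, basisMap_val_mulVec_apply]
    have := norm_gateRPow_zero_sq_le hα hβ h x
    split_ifs with h1 h2 h2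
    · simp; positivity
    · simp
    · rwa [sub_zero]
    · omega
  leaf := by
    ext x
    simp [Matrix.vecMul, dotProduct, basisMap]
  split _ _ := by
    rw [basisMap_kronecker, basisMap_mul, basisMap_mul]
    congr 1

end BitTrees

/-! ### The compressed measurement as a tree -/

section RegisterTree

variable {α β ε : ℝ} {k m : ℕ} {A : Type*} [Fintype A] [DecidableEq A] {a₀ : A}

/-- The encoding of the strings with at most `h` ones. -/
def lowEnc (k m h n : ℕ) (x : LowBits h n) : Reg k m := enc k m x.1

lemma lowEnc_injective {h n : ℕ} (hn : n ≤ m) (hh : h ≤ k + 1) :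
    Function.Injective (lowEnc k m h n) := fun x y hxy =>
  Subtype.ext (enc_injOn hn (x.2.trans hh) (y.2.trans hh) hxy)

lemma one_sub_sqrt_le {e : ℝ} (h0 : 0 ≤ e) (h1 : e ≤ 1) :
    0 ≤ 1 - Real.sqrt (1 - e) ∧ 1 - Real.sqrt (1 - e) ≤ e := by
  have hs := Real.sqrt_nonneg (1 - e)
  have hsq := Real.sq_sqrt (by linarith : 0 ≤ 1 - e)
  constructor <;> nlinarith

/-- The unflagged part of an implemented preparation is encoded from amplitudes that are
relatively `ε`-close to the ideal ones for at most `k` ones. -/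
lemma IsFlaggedPrep.exists_flagFree_eq (hα : 0 ≤ α) (hβ : 0 ≤ β) (h : α ^ 2 + β ^ 2 = 1)
    (hε : ε < 1 / 2) {n : ℕ} {U : Matrix (Reg k m × A) (Reg k m × A) ℂ}
    (hU : IsFlaggedPrep α β ε a₀ n U) :
    ∃ a : LowBits (k + 1) n → ℂ, flagFree a₀ n U = basisMap (lowEnc k m (k + 1) n) *ᵥ a ∧
      (∀ x, wt x.1 ≤ k → ‖a x - prepVec α β n x.1‖ ^ 2 ≤ ε ^ 2 * ‖prepVec α β n x.1‖ ^ 2) ∧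
      ∀ x, ‖a x‖ ^ 2 ≤ (β ^ 2) ^ wt x.1 := by
  obtain ⟨-, e, err, he, herr, -, hcol⟩ := hU
  have hα1 := le_one_of_sq_add_sq h
  refine ⟨fun x => (amp α β k x.1 : ℂ) * (Real.sqrt (1 - e x.1) : ℂ), ?_, fun x hx => ?_,
    fun x => ?_⟩
  · ext s
    rw [flagFree, hcol, Finset.sum_subtype (p := fun x => wt x ≤ k + 1) _ (by simp)]
    simp only [Matrix.mulVec, dotProduct, basisMap, lowEnc, Matrix.of_apply, herr, mul_zero,
      add_zero, Prod.mk.injEq, and_true]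
    exact Finset.sum_congr rfl fun x _ => by split_ifs with hs <;> simp [hs]
  · obtain ⟨h1, h2⟩ := one_sub_sqrt_le (he x.1).1 (by linarith [(he x.1).2])
    have h3 : (amp α β k x.1 : ℂ) = prepVec α β n x.1 := by
      rw [prepVec_eq, amp, if_pos hx]
    have h4 : (amp α β k x.1 : ℂ) * (Real.sqrt (1 - e x.1) : ℂ) - prepVec α β n x.1 =
        -((1 - Real.sqrt (1 - e x.1) : ℝ) : ℂ) * prepVec α β n x.1 := by
      rw [h3]; push_cast; ring
    dsimp only
    rw [h4, norm_mul, norm_neg, Complex.norm_real, Real.norm_of_nonneg h1, mul_pow]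
    gcongr
    exact h2.trans (he x.1).2
  · have h1 : Real.sqrt (1 - e x.1) ≤ 1 := Real.sqrt_le_one.mpr (by linarith [(he x.1).1])
    have h2 : 0 ≤ amp α β k x.1 ∧ amp α β k x.1 ≤ β ^ wt x.1 := by
      rw [amp]
      split_ifs
      · exact ⟨by positivity, mul_le_of_le_one_left (by positivity) (pow_le_one₀ hα hα1)⟩
      · exact ⟨by positivity, mul_le_of_le_one_left (by positivity) (pow_le_one₀ hα hα1)⟩
    have h3 : ‖(amp α β k x.1 : ℂ) * (Real.sqrt (1 - e x.1) : ℂ)‖ ≤ β ^ wt x.1 := by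
      rw [norm_mul, Complex.norm_real, Complex.norm_real, Real.norm_of_nonneg h2.1,
        Real.norm_of_nonneg (Real.sqrt_nonneg _)]
      calc _ ≤ β ^ wt x.1 * 1 := mul_le_mul h2.2 h1 (Real.sqrt_nonneg _) (by positivity)
        _ = _ := mul_one _
    calc _ ≤ (β ^ wt x.1) ^ 2 := by gcongr
      _ = _ := by rw [← pow_mul, ← pow_mul, mul_comm]

lemma lowEnc_eq_comp (n : ℕ) : lowEnc k m k n =
    lowEnc k m (k + 1) n ∘ fun x : LowBits k n => ⟨x.1, x.2.trans (Nat.le_succ k)⟩ := rfl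

/-- Vectors on the strings with at most `k` ones, extended by zero to one more. -/
lemma basisMap_lowEnc_mulVec {n : ℕ} (x : LowBits k n → ℂ) :
    basisMap (lowEnc k m k n) *ᵥ x = basisMap (lowEnc k m (k + 1) n) *ᵥ
      fun y => if hy : wt y.1 ≤ k then x ⟨y.1, hy⟩ else 0 := by
  have hinj : Function.Injective fun x : LowBits k n =>
      (⟨x.1, x.2.trans (Nat.le_succ k)⟩ : LowBits (k + 1) n) :=
    fun x y hxy => Subtype.ext (congrArg (fun z : LowBits (k + 1) n => z.1) hxy)
  rw [lowEnc_eq_comp, ← basisMap_mul, ← Matrix.mulVec_mulVec]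
  congr 1
  ext y
  split_ifs with hy
  · exact basisMap_mulVec_apply hinj x ⟨y.1, hy⟩
  · refine Finset.sum_eq_zero fun j _ => ?_
    have : y ≠ ⟨j.1, j.2.trans (Nat.le_succ k)⟩ := fun e => hy (e ▸ j.2)
    simp [basisMap, this]

lemma sum_lowBits_le {h n : ℕ} (F : Bits n → ℝ) (hF : ∀ x, 0 ≤ F x) :
    ∑ x : LowBits h n, F x.1 ≤ ∑ x, F x := by
  rw [← Finset.sum_subtype (Finset.univ.filter fun x => wt x ≤ h) (by simp) F]
  exact Finset.sum_le_sum_of_subset_of_nonneg (Finset.subset_univ _) fun _ _ _ => hF _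

lemma IsFlaggedPrep.conjTranspose_mul_self {n : ℕ} {U : Matrix (Reg k m × A) (Reg k m × A) ℂ}
    (hU : IsFlaggedPrep α β ε a₀ n U) : Uᴴ * U = 1 :=
  Matrix.mem_unitaryGroup_iff'.mp hU.1

variable {U : ℕ → Matrix (Reg k m × A) (Reg k m × A) ℂ}
  {S : ℕ → Matrix (Reg k m × Reg k m) (Reg k m) ℂ}

/-- The leaf vector of the register tree: the encoded second row of `R`. -/
def regLeaf (α β : ℝ) (k m : ℕ) : Reg k m → ℂ :=
  basisMap (lowEnc k m k (2 ^ 0)) *ᵥ fun x => gateRPow α β (2 ^ 0) (fun _ => true) x.1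

lemma nsq_regLeaf_le (h : α ^ 2 + β ^ 2 = 1) (hm : 1 ≤ m) : nsq (regLeaf α β k m) ≤ 1 := by
  rw [regLeaf, nsq_mulVec_of_isometry
    (basisMap_isometry (lowEnc_injective (n := 2 ^ 0) hm (Nat.le_succ k)))]
  exact (isTree_lowBits h 0 k).leaf

lemma isTree_register {p : ℕ} (h : α ^ 2 + β ^ 2 = 1) (hm : 1 ≤ m)
    (hU : ∀ q ≤ p, (U q)ᴴ * U q = 1) (hS : ∀ q < p, (S q)ᴴ * S q = 1) :
    IsTree (Z := fun _ => Reg k m) p (fun q => flagFree a₀ (2 ^ q) (U q)) (regLeaf α β k m) S where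
  prep q hq := nsq_flagFree_le (hU q hq)
  leaf := nsq_regLeaf_le h hm
  split := hS

/-- The encoding carries the truncated tree to the tree of the compressed measurement, up to the
implementation error and the tail of the prepared states. -/
lemma isApproxEmbedding_register {p : ℕ} {d : ℝ} (hα : 0 ≤ α) (hβ : 0 ≤ β)
    (h : α ^ 2 + β ^ 2 = 1) (hε : ε < 1 / 2) (hm : 2 ^ p ≤ m)
    (hU : ∀ q ≤ p, IsFlaggedPrep α β ε a₀ (2 ^ q) (U q)) (hS : ∀ q < p, IsSplit q (S q))
    (htail : ∀ q ≤ p, ∑ x : Bits (2 ^ q) with k ≤ wt x, (β ^ 2) ^ wt x ≤ ε ^ 2)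
    (hd : 2 * ε ^ 2 ≤ d ^ 2) :
    IsApproxEmbedding (Z := fun _ => Reg k m) (Y := fun q => LowBits k (2 ^ q)) p d
      (fun q => basisMap (lowEnc k m k (2 ^ q)))
      (fun q => flagFree a₀ (2 ^ q) (U q)) (regLeaf α β k m) S
      (fun q x => prepVec α β (2 ^ q) x.1) (fun x => gateRPow α β (2 ^ 0) (fun _ => true) x.1)
      (fun q => basisMap (lowHalves k q)) where
  isometry q hq := basisMap_isometry
    (lowEnc_injective ((Nat.pow_le_pow_right two_pos hq).trans hm) (Nat.le_succ k))
  prep q hq := by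
    have hqm : 2 ^ q ≤ m := (Nat.pow_le_pow_right two_pos hq).trans hm
    obtain ⟨a, ha, ha1, ha2⟩ := (hU q hq).exists_flagFree_eq hα hβ h hε
    rw [ha, basisMap_lowEnc_mulVec, ← Matrix.mulVec_sub,
      nsq_mulVec_of_isometry (basisMap_isometry (lowEnc_injective hqm le_rfl))]
    refine le_trans ?_ hd
    set F : Bits (2 ^ q) → ℝ := fun x => ε ^ 2 * ‖prepVec α β (2 ^ q) x‖ ^ 2 +
      if k ≤ wt x then (β ^ 2) ^ wt x else 0 with hF
    have hF0 : ∀ x, 0 ≤ F x := fun x => by simp only [hF]; split_ifs <;> positivity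
    calc _ ≤ ∑ x : LowBits (k + 1) (2 ^ q), F x.1 := by
          refine Finset.sum_le_sum fun x _ => ?_
          simp only [Pi.sub_apply, hF]
          have h0 : 0 ≤ ε ^ 2 * ‖prepVec α β (2 ^ q) x.1‖ ^ 2 := by positivity
          by_cases hx : wt x.1 ≤ k
          · rw [dif_pos hx]
            refine (ha1 x hx).trans (le_add_of_nonneg_right ?_)
            split_ifs <;> positivity
          · rw [dif_neg hx, sub_zero, if_pos (by omega)]
            have := ha2 x
            linarith
      _ ≤ ∑ x, F x := sum_lowBits_le F hF0
      _ = ε ^ 2 * nsq (prepVec α β (2 ^ q)) +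
          ∑ x : Bits (2 ^ q) with k ≤ wt x, (β ^ 2) ^ wt x := by
          rw [Finset.sum_add_distrib, ← Finset.mul_sum, Finset.sum_filter, nsq]
      _ ≤ 2 * ε ^ 2 := by rw [nsq_prepVec h]; linarith [htail q hq]
  leaf := basisMap_mulVec_vecMul (lowEnc_injective
    ((Nat.pow_le_pow_right two_pos (Nat.zero_le p)).trans hm) (Nat.le_succ k)) _
  split q hq := by
    rw [basisMap_kronecker, basisMap_mul]
    ext z x
    rw [mul_basisMap, lowEnc, (hS q hq).2 x.1 x.2]
    rfl

end RegisterTree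

/-! ### Comparison of the conditional target states -/

lemma norm_add_add_add_sq_le (a b c d : ℂ) :
    ‖a + b + c + d‖ ^ 2 ≤ 4 * (‖a‖ ^ 2 + ‖b‖ ^ 2 + ‖c‖ ^ 2 + ‖d‖ ^ 2) := by
  have h : ‖a + b + c + d‖ ≤ ‖a‖ + ‖b‖ + ‖c‖ + ‖d‖ := norm_add₄_le
  have h0 := norm_nonneg (a + b + c + d)
  nlinarith [sq_nonneg (‖a‖ - ‖b‖), sq_nonneg (‖a‖ - ‖c‖), sq_nonneg (‖a‖ - ‖d‖),
    sq_nonneg (‖b‖ - ‖c‖), sq_nonneg (‖b‖ - ‖d‖), sq_nonneg (‖c‖ - ‖d‖)]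

section Amplitudes

variable {Z Z' Y : ℕ → Type} [∀ q, Fintype (Z q)] [∀ q, DecidableEq (Z q)]
  [∀ q, Fintype (Z' q)] [∀ q, DecidableEq (Z' q)] [∀ q, Fintype (Y q)] [∀ q, DecidableEq (Y q)]
  {p : ℕ} {d : ℝ} {τ : Type*} [Fintype τ]
  {φ : ∀ q, Z q → ℂ} {θ : Z 0 → ℂ} {S : ∀ q, Matrix (Z q × Z q) (Z (q + 1)) ℂ}
  {φ' : ∀ q, Z' q → ℂ} {θ' : Z' 0 → ℂ} {S' : ∀ q, Matrix (Z' q × Z' q) (Z' (q + 1)) ℂ}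
  {χ : ∀ q, Y q → ℂ} {η : Y 0 → ℂ} {T : ∀ q, Matrix (Y q × Y q) (Y (q + 1)) ℂ}
  {V : ∀ q, Matrix (Z q) (Y q) ℂ} {V' : ∀ q, Matrix (Z' q) (Y q) ℂ}

lemma IsTree.sum_nsq_contract_le (hS : IsTree p φ θ S) (ψ : Z p × τ → ℂ) :
    ∑ b, nsq (contract (treeRow φ θ S p b) ψ) ≤ nsq ψ := by
  calc _ = ∑ t, ∑ b, ‖treeRow φ θ S p b ⬝ᵥ fun i => ψ (i, t)‖ ^ 2 := Finset.sum_comm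
    _ ≤ ∑ t, nsq fun i => ψ (i, t) := Finset.sum_le_sum fun t _ => hS.sum_treeRow_le le_rfl _
    _ = nsq ψ := (nsq_prod ψ).symm

/-- Two trees that are approximated by a common third one give nearby conditional states when they
are run on nearby initial states. -/
lemma sum_nsq_contract_sub_le (hS : IsTree p φ θ S) (hS' : IsTree p φ' θ' S') (hT : IsTree p χ η T)
    (hV : IsApproxEmbedding p d V φ θ S χ η T) (hV' : IsApproxEmbedding p d V' φ' θ' S' χ η T)
    (h : ℕ) (ψ : Z p × τ → ℂ) (ψ' : Z' p × τ → ℂ) (ψ₀ : Y p × τ → ℂ) (hψ₀ : nsq ψ₀ ≤ 1)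
    {r r' : ℝ}
    (hr : ∑ t, nsq ((fun z => ψ (z, t)) - V p *ᵥ fun y => ψ₀ (y, t)) ≤ r)
    (hr' : ∑ t, nsq ((fun z => ψ' (z, t)) - V' p *ᵥ fun y => ψ₀ (y, t)) ≤ r') :
    ∑ b with wt b ≤ h,
      nsq (contract (treeRow φ θ S p b) ψ - contract (treeRow φ' θ' S' p b) ψ')
      ≤ 4 * (r + r' + 10 * d ^ 2 * (1 + 2 * p * (h + 1)) ^ 2) := by
  set s : τ → Z p → ℂ := fun t => (fun z => ψ (z, t)) - V p *ᵥ fun y => ψ₀ (y, t)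
  set s' : τ → Z' p → ℂ := fun t => (fun z => ψ' (z, t)) - V' p *ᵥ fun y => ψ₀ (y, t)
  set N : ℝ := 5 * d ^ 2 * (1 + 2 * p * (h + 1)) ^ 2 with hN
  have hN0 : 0 ≤ N := by positivity
  have hterm : ∀ b t, ‖(contract (treeRow φ θ S p b) ψ - contract (treeRow φ' θ' S' p b) ψ') t‖ ^ 2
      ≤ 4 * (‖treeRow φ θ S p b ⬝ᵥ s t‖ ^ 2 +
        ‖treeErr V φ θ S χ η T p b fun y => ψ₀ (y, t)‖ ^ 2 +
        ‖treeErr V' φ' θ' S' χ η T p b fun y => ψ₀ (y, t)‖ ^ 2 +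
        ‖treeRow φ' θ' S' p b ⬝ᵥ s' t‖ ^ 2) := by
    intro b t
    have e : (contract (treeRow φ θ S p b) ψ - contract (treeRow φ' θ' S' p b) ψ') t =
        treeRow φ θ S p b ⬝ᵥ s t + treeErr V φ θ S χ η T p b (fun y => ψ₀ (y, t)) +
        -treeErr V' φ' θ' S' χ η T p b (fun y => ψ₀ (y, t)) +
        -(treeRow φ' θ' S' p b ⬝ᵥ s' t) := by
      simp only [Pi.sub_apply, contract, treeErr, s, s', dotProduct_sub]
      ring
    rw [e]
    refine (norm_add_add_add_sq_le _ _ _ _).trans (le_of_eq ?_)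
    rw [norm_neg, norm_neg]
  have hsub : ∀ F : Bits (2 ^ p) → ℝ, (∀ b, 0 ≤ F b) → ∑ b with wt b ≤ h, F b ≤ ∑ b, F b :=
    fun F hF => Finset.sum_le_sum_of_subset_of_nonneg (Finset.subset_univ _) fun b _ _ => hF b
  have h1 : ∑ t, ∑ b with wt b ≤ h, ‖treeRow φ θ S p b ⬝ᵥ s t‖ ^ 2 ≤ r :=
    (Finset.sum_le_sum fun t _ => (hsub _ fun _ => by positivity).trans
      (hS.sum_treeRow_le le_rfl _)).trans hr
  have h4 : ∑ t, ∑ b with wt b ≤ h, ‖treeRow φ' θ' S' p b ⬝ᵥ s' t‖ ^ 2 ≤ r' :=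
    (Finset.sum_le_sum fun t _ => (hsub _ fun _ => by positivity).trans
      (hS'.sum_treeRow_le le_rfl _)).trans hr'
  have hsum : ∑ t, N * nsq (fun y => ψ₀ (y, t)) ≤ N := by
    rw [← Finset.mul_sum, ← nsq_prod]
    exact mul_le_of_le_one_right hN0 hψ₀
  have h2 := (Finset.sum_le_sum fun t (_ : t ∈ Finset.univ) =>
    sum_treeErr_sq_le hS hT hV le_rfl h fun y => ψ₀ (y, t)).trans hsum
  have h3 := (Finset.sum_le_sum fun t (_ : t ∈ Finset.univ) =>
    sum_treeErr_sq_le hS' hT hV' le_rfl h fun y => ψ₀ (y, t)).trans hsum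
  calc _ = ∑ t, ∑ b with wt b ≤ h,
        ‖(contract (treeRow φ θ S p b) ψ - contract (treeRow φ' θ' S' p b) ψ') t‖ ^ 2 := by
        simp only [nsq]
        rw [Finset.sum_comm]
    _ ≤ _ := Finset.sum_le_sum fun t _ => Finset.sum_le_sum fun b _ => hterm b t
    _ ≤ _ := by
        simp only [← Finset.mul_sum, Finset.sum_add_distrib]
        linarith

end Amplitudes

/-- From amplitudes to trace norms.  On the outcomes in `G` the measurement results `M b` dominate
pure states that are `ℓ²`-close to the ideal ones; normalisation controls the excess of `M b` and
all other outcomes. -/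
lemma sum_traceNorm_sub_le {B τ : Type*} [Fintype B] [DecidableEq B] [Fintype τ] [DecidableEq τ]
    (G : Finset B) (u v : B → τ → ℂ) (M : B → Matrix τ τ ℂ) {D : ℝ} (hD : 0 < D)
    (hu : ∑ b, nsq (u b) = 1) (hv : ∑ b ∈ G, nsq (v b) ≤ 1) (hM : ∀ b, (M b).PosSemidef)
    (htr : ∑ b, (M b).trace.re = 1) (hMv : ∀ b ∈ G, (M b - pureState (v b)).PosSemidef)
    (huv : ∑ b ∈ G, nsq (u b - v b) ≤ D ^ 2) :
    ∑ b, traceNorm (pureState (u b) - M b) ≤ 4 * D + 2 * ∑ b ∈ Gᶜ, nsq (u b) := by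
  have hs : 0 < D / 2 := by positivity
  have huG : ∑ b ∈ G, nsq (u b) + ∑ b ∈ Gᶜ, nsq (u b) = 1 := by
    rw [Finset.sum_add_sum_compl, hu]
  have htG : ∑ b ∈ G, (M b).trace.re + ∑ b ∈ Gᶜ, (M b).trace.re = 1 := by
    rw [Finset.sum_add_sum_compl, htr]
  have huc : 0 ≤ ∑ b ∈ Gᶜ, nsq (u b) := Finset.sum_nonneg fun _ _ => nsq_nonneg _
  set e : B → ℝ := fun b => (D / 2 * nsq (u b + v b) + nsq (u b - v b) / (D / 2)) / 2
  -- a good outcome costs the distance of the pure states and the excess of `M b`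
  have h1 : ∀ b ∈ G, traceNorm (pureState (u b) - M b) ≤ e b + ((M b).trace.re - nsq (v b)) := by
    intro b hb
    obtain ⟨P, N, hP, hN, hPN, hval⟩ := exists_pureState_sub_eq (u b) (v b) hs
    have e1 : pureState (u b) - M b = P - (N + (M b - pureState (v b))) := by
      rw [← sub_sub, ← hPN]; abel
    rw [e1]
    refine (traceNorm_sub_le hP (hN.add (hMv b hb))).trans (le_of_eq ?_)
    rw [Matrix.trace_add, Matrix.trace_sub, trace_pureState, Complex.add_re, Complex.sub_re,
      Complex.ofReal_re]
    simp only [e]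
    linarith
  have h2 : ∀ b ∈ G, nsq (u b) - nsq (v b) ≤ e b := by
    intro b _
    obtain ⟨P, N, hP, hN, hPN, hval⟩ := exists_pureState_sub_eq (u b) (v b) hs
    have ht := congrArg (fun X => (Matrix.trace X).re) hPN
    simp only [Matrix.trace_sub, trace_pureState, Complex.sub_re, Complex.ofReal_re] at ht
    have := (Complex.le_def.mp hN.trace_nonneg).1
    rw [Complex.zero_re] at this
    simp only [e]
    linarith
  have h3 : ∀ b ∈ Gᶜ, traceNorm (pureState (u b) - M b) ≤ nsq (u b) + (M b).trace.re := by
    intro b _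
    refine (traceNorm_sub_le (posSemidef_pureState _) (hM b)).trans (le_of_eq ?_)
    rw [trace_pureState, Complex.ofReal_re]
  have he : ∑ b ∈ G, e b ≤ 2 * D := by
    have h4 : ∑ b ∈ G, nsq (u b + v b) ≤ 4 := by
      refine (Finset.sum_le_sum fun b _ => nsq_add_le (u b) (v b)).trans ?_
      rw [Finset.sum_add_distrib, ← Finset.mul_sum, ← Finset.mul_sum]
      linarith
    simp only [e]
    rw [← Finset.sum_div, Finset.sum_add_distrib, ← Finset.mul_sum, ← Finset.sum_div]
    have h5 : (∑ b ∈ G, nsq (u b - v b)) / (D / 2) ≤ 2 * D := by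
      rw [div_le_iff₀ hs]; linarith
    nlinarith
  rw [← Finset.sum_add_sum_compl G]
  have h6 := Finset.sum_le_sum h1
  have h7 := Finset.sum_le_sum h2
  have h8 := Finset.sum_le_sum h3
  simp only [Finset.sum_add_distrib, Finset.sum_sub_distrib] at h6 h7 h8
  linarith

/-! ### The initial states -/

section States

variable {α β ε ε' : ℝ} {k k' p : ℕ} {A : Type*} [Fintype A] [DecidableEq A] {a₀ : A}
  {τ : Type} [Fintype τ] [DecidableEq τ]

lemma uncOutcome_eq {m : ℕ} (w : Bits m → τ → ℂ) (b : Bits m) :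
    uncOutcome α β w b = pureState (contract (gateRPow α β m b) (uncState α β w)) := by
  rw [uncOutcome, traceLeft_applyLeft, Finset.sum_eq_single b]
  · rw [← applyRow_pureState]
    congr 1
    ext x
    simp [Matrix.single_mul_apply_same]
  · intro b' _ hb'
    have : (Matrix.single b b (1 : ℂ) * gateRPow α β m) b' = (0 : ℂ) • (0 : Bits m → ℂ) := by
      ext x
      simp [Matrix.single_mul_apply_of_ne (h := hb')]
    rw [this, applyRow_smul]
    simp
  · simp

lemma norm_I_pow (n : ℕ) : ‖Complex.I ^ n‖ = 1 := by rw [norm_pow, Complex.norm_I, one_pow]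

lemma sum_norm_mul_sq {c : ℂ} {w : τ → ℂ} (hw : ∑ t, ‖w t‖ ^ 2 = 1) :
    ∑ t, ‖c * w t‖ ^ 2 = ‖c‖ ^ 2 := by
  simp only [norm_mul, mul_pow]
  rw [← Finset.mul_sum, hw, mul_one]

lemma nsq_uncState (h : α ^ 2 + β ^ 2 = 1) {m : ℕ} {w : Bits m → τ → ℂ}
    (hw : ∀ x, ∑ t, ‖w x t‖ ^ 2 = 1) : nsq (uncState α β w) = 1 := by
  rw [← nsq_prepVec h m, nsq, Fintype.sum_prod_type]
  refine Finset.sum_congr rfl fun x _ => ?_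
  simp only [uncState, sum_norm_mul_sq (hw x)]
  simp only [norm_mul, norm_I_pow, one_mul, prepVec]

/-- Without any cancellation, every one in the outcome costs a factor `2 α β`. -/
lemma nsq_contract_uncState_le (hα : 0 ≤ α) (hβ : 0 ≤ β) (h : α ^ 2 + β ^ 2 = 1) {m : ℕ}
    {w : Bits m → τ → ℂ} (hw : ∀ x, ∑ t, ‖w x t‖ ^ 2 = 1) (b : Bits m) :
    nsq (contract (gateRPow α β m b) (uncState α β w)) ≤ (4 * β ^ 2) ^ wt b := by
  set c : Bits m → ℂ := fun x => gateRPow α β m b x *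
    (Complex.I ^ wt x * gateRPow α β m x (zeroBits m))
  have e : contract (gateRPow α β m b) (uncState α β w) = ∑ x, c x • w x := by
    ext t
    simp only [contract, dotProduct, uncState, Finset.sum_apply, Pi.smul_apply, smul_eq_mul, c]
    exact Finset.sum_congr rfl fun x _ => by ring
  have hwn : ∀ x, ‖WithLp.toLp 2 (w x)‖ = 1 := by
    intro x
    have h1 : ‖WithLp.toLp 2 (w x)‖ ^ 2 = 1 := by rw [← nsq_eq_norm_sq, nsq, hw x]
    exact (pow_eq_one_iff_of_nonneg (norm_nonneg _) two_ne_zero).mp h1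
  have hn : ‖WithLp.toLp 2 (∑ x, c x • w x)‖ ≤ (2 * α * β) ^ wt b := by
    rw [WithLp.toLp_sum]
    refine (norm_sum_le _ _).trans (le_of_eq ?_)
    rw [← sum_norm_gateRPow_mul hα hβ h b]
    refine Finset.sum_congr rfl fun x _ => ?_
    rw [WithLp.toLp_smul, norm_smul, hwn, mul_one]
    simp only [c, norm_mul, norm_I_pow, one_mul]
  rw [e, nsq_eq_norm_sq]
  calc _ ≤ ((2 * α * β) ^ wt b) ^ 2 := by gcongr
    _ = ((2 * α * β) ^ 2) ^ wt b := by rw [← pow_mul, ← pow_mul, mul_comm (wt b) 2]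
    _ ≤ _ := by
        gcongr
        nlinarith [mul_nonneg (sq_nonneg β) (sq_nonneg β)]

/-- The initial state of the uncompressed scheme, restricted to the strings with at most `k` and
`k'` ones. -/
def lowState (α β : ℝ) (k k' : ℕ) {m : ℕ} (w : Bits m → τ → ℂ) : LowBits k m × τ → ℂ :=
  fun z => if wt z.1.1 ≤ k' then uncState α β w (z.1.1, z.2) else 0

lemma nsq_lowState_le (h : α ^ 2 + β ^ 2 = 1) {m : ℕ} {w : Bits m → τ → ℂ}
    (hw : ∀ x, ∑ t, ‖w x t‖ ^ 2 = 1) : nsq (lowState α β k k' w) ≤ 1 := by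
  rw [← nsq_uncState h hw, nsq_prod, nsq_prod]
  refine Finset.sum_le_sum fun t _ => ?_
  refine le_trans (Finset.sum_le_sum fun x _ => ?_)
    (nsq_comp_val_le (fun x => wt x ≤ k) fun x => uncState α β w (x, t))
  simp only [lowState]
  split_ifs
  · exact le_rfl
  · simp

/-- The flag-free part of the initial state of the compressed scheme. -/
def regState (a₀ : A) {m : ℕ} (U : Matrix (Reg k m × A) (Reg k m × A) ℂ) (w' : Reg k m → τ → ℂ) :
    Reg k m × τ → ℂ :=
  fun z => flagFree a₀ m U z.1 *
    Complex.I ^ (Finset.univ.filter fun i => z.1 i ≠ Fin.last m).card * w' z.1 z.2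

lemma sum_tail_le {m : ℕ} {r r' : ℝ} {F : Bits m → ℝ} (hF : ∀ x, 0 ≤ F x)
    (h : ∑ x with k ≤ wt x, F x ≤ r) (h' : ∑ x with k' ≤ wt x, F x ≤ r') :
    (∑ x, if wt x ≤ k ∧ wt x ≤ k' then 0 else F x) ≤ r + r' := by
  rw [Finset.sum_filter] at h h'
  refine le_trans ?_ (add_le_add h h')
  rw [← Finset.sum_add_distrib]
  refine Finset.sum_le_sum fun x _ => ?_
  have := hF x
  split_ifs <;> first | omega | linarith

/-- The truncated initial state misses only the two tails. -/
lemma sum_nsq_uncState_sub_le (hα : 0 ≤ α) (hβ : 0 ≤ β) (h : α ^ 2 + β ^ 2 = 1)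
    {w : Bits (2 ^ p) → τ → ℂ} (hw : ∀ x, ∑ t, ‖w x t‖ ^ 2 = 1) {r r' : ℝ}
    (hr : ∑ x : Bits (2 ^ p) with k ≤ wt x, (β ^ 2) ^ wt x ≤ r)
    (hr' : ∑ x : Bits (2 ^ p) with k' ≤ wt x, (β ^ 2) ^ wt x ≤ r') :
    ∑ t, nsq ((fun z => uncState α β w (z, t)) -
      basisMap (Subtype.val : LowBits k (2 ^ p) → _) *ᵥ fun y => lowState α β k k' w (y, t))
      ≤ r + r' := by
  refine le_trans ?_ (sum_tail_le (fun x => by positivity) hr hr')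
  simp only [nsq]
  rw [Finset.sum_comm]
  refine Finset.sum_le_sum fun x _ => ?_
  simp only [Pi.sub_apply, basisMap_val_mulVec_apply, lowState]
  by_cases hk : wt x ≤ k <;> by_cases hk' : wt x ≤ k' <;>
    simp only [hk, hk', dif_pos, if_true, and_self, sub_self, norm_zero, dite_false, if_false,
      sub_zero, and_false, false_and]
  · simp
  all_goals
    simp only [uncState, sum_norm_mul_sq (hw x)]
    simp only [norm_mul, norm_I_pow, one_mul]
    exact norm_gateRPow_zero_sq_le hα hβ h x

/-- On the strings with at most `k` and `k'` ones the two schemes prepare the same target states, so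
that the encoded truncated state misses the implementation error and the two tails. -/
lemma sum_nsq_regState_sub_le (hα : 0 ≤ α) (hβ : 0 ≤ β) (h : α ^ 2 + β ^ 2 = 1)
    (hε : ε < 1 / 2) {U : Matrix (Reg k (2 ^ p) × A) (Reg k (2 ^ p) × A) ℂ}
    (hU : IsFlaggedPrep α β ε a₀ (2 ^ p) U)
    {w : Bits (2 ^ p) → τ → ℂ} {w' : Reg k (2 ^ p) → τ → ℂ}
    (hw' : ∀ s, ∑ t, ‖w' s t‖ ^ 2 = 1)
    (hww : ∀ x, wt x ≤ k → wt x ≤ k' → w' (enc k (2 ^ p) x) = w x) {r r' : ℝ}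
    (hr : ∑ x : Bits (2 ^ p) with k ≤ wt x, (β ^ 2) ^ wt x ≤ r)
    (hr' : ∑ x : Bits (2 ^ p) with k' ≤ wt x, (β ^ 2) ^ wt x ≤ r') :
    ∑ t, nsq ((fun s => regState a₀ U w' (s, t)) -
      basisMap (lowEnc k (2 ^ p) k (2 ^ p)) *ᵥ fun y => lowState α β k k' w (y, t))
      ≤ ε ^ 2 + (r + r') := by
  obtain ⟨a, ha, ha1, ha2⟩ := hU.exists_flagFree_eq hα hβ h hε
  have hinj := lowEnc_injective (k := k) (m := 2 ^ p) (h := k + 1) le_rfl le_rfl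
  -- the phase and the target state of the compressed scheme, in terms of bit strings
  set g : LowBits (k + 1) (2 ^ p) → τ → ℂ := fun x t =>
    Complex.I ^ (Finset.univ.filter fun i => enc k (2 ^ p) x.1 i ≠ Fin.last (2 ^ p)).card *
      w' (enc k (2 ^ p) x.1) t with hg
  have hgn : ∀ x, ∑ t, ‖g x t‖ ^ 2 = 1 := by
    intro x
    simp only [hg]
    rw [sum_norm_mul_sq (hw' _), norm_I_pow, one_pow]
  have hreg : ∀ t, (fun s => regState a₀ U w' (s, t)) =
      basisMap (lowEnc k (2 ^ p) (k + 1) (2 ^ p)) *ᵥ fun x => a x * g x t := by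
    intro t
    ext s
    simp only [regState, ha, Matrix.mulVec, dotProduct, basisMap, Matrix.of_apply, Finset.sum_mul]
    refine Finset.sum_congr rfl fun x _ => ?_
    split_ifs with hs
    · simp only [hs, lowEnc, hg]; ring
    · simp
  set F : Bits (2 ^ p) → ℝ := fun x => ε ^ 2 * ‖prepVec α β (2 ^ p) x‖ ^ 2 +
    if wt x ≤ k ∧ wt x ≤ k' then 0 else (β ^ 2) ^ wt x with hF
  have hF0 : ∀ x, 0 ≤ F x := fun x => by simp only [hF]; split_ifs <;> positivity
  have hterm : ∀ x : LowBits (k + 1) (2 ^ p), ∑ t, ‖a x * g x t -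
      (if hy : wt x.1 ≤ k then lowState α β k k' w (⟨x.1, hy⟩, t) else 0)‖ ^ 2 ≤ F x.1 := by
    intro x
    have h0 : 0 ≤ ε ^ 2 * ‖prepVec α β (2 ^ p) x.1‖ ^ 2 := by positivity
    by_cases hx : wt x.1 ≤ k ∧ wt x.1 ≤ k'
    · have e : ∀ t, a x * g x t -
          (if hy : wt x.1 ≤ k then lowState α β k k' w (⟨x.1, hy⟩, t) else 0) =
          (a x - prepVec α β (2 ^ p) x.1) * g x t := by
        intro t
        rw [dif_pos hx.1]
        simp only [lowState, if_pos hx.2, uncState, hg, card_enc_ne_last hx.1, hww x.1 hx.1 hx.2,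
          prepVec]
        ring
      simp only [e, sum_norm_mul_sq (hgn x), hF, if_pos hx, add_zero]
      exact ha1 x hx.1
    · have e : ∀ t, a x * g x t -
          (if hy : wt x.1 ≤ k then lowState α β k k' w (⟨x.1, hy⟩, t) else 0) =
          a x * g x t := by
        intro t
        rw [sub_eq_self]
        split_ifs with hy
        · exact if_neg fun hy' => hx ⟨hy, hy'⟩
        · rfl
      simp only [e, sum_norm_mul_sq (hgn x), hF, if_neg hx]
      linarith [ha2 x]
  calc _ = ∑ x : LowBits (k + 1) (2 ^ p), ∑ t, ‖a x * g x t -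
        (if hy : wt x.1 ≤ k then lowState α β k k' w (⟨x.1, hy⟩, t) else 0)‖ ^ 2 := by
        rw [Finset.sum_comm]
        refine Finset.sum_congr rfl fun t _ => ?_
        rw [hreg, basisMap_lowEnc_mulVec, ← Matrix.mulVec_sub,
          nsq_mulVec_of_isometry (basisMap_isometry hinj)]
        rfl
    _ ≤ ∑ x : LowBits (k + 1) (2 ^ p), F x.1 := Finset.sum_le_sum fun x _ => hterm x
    _ ≤ ∑ x, F x := sum_lowBits_le F hF0
    _ ≤ ε ^ 2 + (r + r') := by
        rw [Finset.sum_add_distrib, ← Finset.mul_sum]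
        have h1 := nsq_prepVec h (2 ^ p)
        rw [nsq] at h1
        rw [h1, mul_one]
        gcongr
        exact sum_tail_le (fun x => by positivity) hr hr'

lemma nsq_regState_le {m : ℕ} {U : Matrix (Reg k m × A) (Reg k m × A) ℂ} (hU : Uᴴ * U = 1)
    {w' : Reg k m → τ → ℂ} (hw' : ∀ s, ∑ t, ‖w' s t‖ ^ 2 = 1) : nsq (regState a₀ U w') ≤ 1 := by
  refine le_trans (le_of_eq ?_) (nsq_flagFree_le (a₀ := a₀) (n := m) hU)
  rw [nsq, Fintype.sum_prod_type]
  refine Finset.sum_congr rfl fun s _ => ?_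
  simp only [regState, sum_norm_mul_sq (hw' s)]
  simp only [norm_mul, norm_I_pow, mul_one]

lemma posSemidef_comState (a₀ : A) {m : ℕ} (U : Matrix (Reg k m × A) (Reg k m × A) ℂ)
    (w' : Reg k m → τ → ℂ) : (comState a₀ U w').PosSemidef :=
  Matrix.posSemidef_sum _ fun _ _ => posSemidef_pureState _

lemma posSemidef_comState_sub (a₀ : A) {m : ℕ} (U : Matrix (Reg k m × A) (Reg k m × A) ℂ)
    (w' : Reg k m → τ → ℂ) : (comState a₀ U w' - pureState (regState a₀ U w')).PosSemidef := by
  rw [comState, ← Finset.add_sum_erase _ _ (Finset.mem_univ a₀)]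
  change (pureState (regState a₀ U w') + _ - _).PosSemidef
  rw [add_sub_cancel_left]
  exact Matrix.posSemidef_sum _ fun _ _ => posSemidef_pureState _

lemma trace_comState (a₀ : A) {m : ℕ} {U : Matrix (Reg k m × A) (Reg k m × A) ℂ}
    (hU : Uᴴ * U = 1) {w' : Reg k m → τ → ℂ} (hw' : ∀ s, ∑ t, ‖w' s t‖ ^ 2 = 1) :
    (comState a₀ U w').trace = 1 := by
  rw [comState, Matrix.trace_sum]
  simp only [trace_pureState]
  rw [← Complex.ofReal_sum, ← Complex.ofReal_one]
  congr 1
  rw [← sum_norm_sq_col hU (enc k m (zeroBits m), a₀), nsq_prod]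
  refine Finset.sum_congr rfl fun a _ => ?_
  rw [nsq, Fintype.sum_prod_type]
  refine Finset.sum_congr rfl fun s _ => ?_
  simp only [sum_norm_mul_sq (hw' s)]
  simp only [norm_mul, norm_I_pow, mul_one]

/-- Before the limit is reached, the outcome of the compressed scheme contains the pure state of
the branch in which no flag is raised. -/
lemma posSemidef_comOutcome_sub {U : ℕ → Matrix (Reg k (2 ^ p) × A) (Reg k (2 ^ p) × A) ℂ}
    {S : ℕ → Matrix (Reg k (2 ^ p) × Reg k (2 ^ p)) (Reg k (2 ^ p)) ℂ}
    (hU : ∀ q ≤ p, (U q)ᴴ * U q = 1) {θ : Reg k (2 ^ p) → ℂ} (hθ : nsq θ ≤ 1)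
    (w' : Reg k (2 ^ p) → τ → ℂ) {limit : ℕ} {b : Bits (2 ^ p)} (hb : wt b < limit) :
    (comOutcome a₀ U S limit w' b -
      pureState (contract (registerRow a₀ U S θ p b) (regState a₀ (U p) w'))).PosSemidef := by
  have h1 := posSemidef_measure_sub_applyRow (a₀ := a₀) (S := S) hU hθ le_rfl
    (posSemidef_comState a₀ (U p) w') hb
  have h2 := posSemidef_applyRow (registerRow a₀ U S θ p b) (posSemidef_comState_sub a₀ (U p) w')
  rw [applyRow_sub, applyRow_pureState] at h2
  have h3 := h1.add h2
  rwa [sub_add_sub_cancel] at h3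

end States

end CompressedMeasurement

end

open CompressedMeasurement
theorem theorem4 (κ : ℝ) (hκ : 0 < κ) :
    ∃ c C : ℝ, 0 < c ∧ 0 < C ∧
      ∀ (p k k' limit : ℕ) (α β ε ε' : ℝ),
        1 ≤ p →
        0 ≤ α → 0 ≤ β → α ^ 2 + β ^ 2 = 1 → β ^ 2 * (2 : ℝ) ^ p ≤ κ →
        0 < ε → ε < 1 / 2 → 0 < ε' → ε' < 1 / 2 →
        c * cutoff ε ≤ k →
        c * cutoff ε' ≤ k' →
        k' ≤ limit →
      ∀ (A τ : Type) [Fintype A] [DecidableEq A] [Fintype τ] [DecidableEq τ] (a₀ : A)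
        (U : ℕ → Matrix (Reg k (2 ^ p) × A) (Reg k (2 ^ p) × A) ℂ)
        (S : ℕ → Matrix (Reg k (2 ^ p) × Reg k (2 ^ p)) (Reg k (2 ^ p)) ℂ)
        (w : Bits (2 ^ p) → τ → ℂ)
        (w' : Reg k (2 ^ p) → τ → ℂ),
        (∀ q ≤ p, IsFlaggedPrep α β ε a₀ (2 ^ q) (U q)) →
        (∀ q < p, IsSplit q (S q)) →
        (∀ x, ∑ t, ‖w x t‖ ^ 2 = 1) →
        (∀ s, ∑ t, ‖w' s t‖ ^ 2 = 1) →
        (∀ x, wt x ≤ k → wt x ≤ k' →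
          w' (enc k (2 ^ p) x) = w x) →
        Dav (uncOutcome α β w) (comOutcome a₀ U S limit w')
          ≤ C * (ε' + ε * k' * Real.logb 2 ((2 : ℝ) ^ p)) := by
  have hlog2 : 0 < Real.log 2 := Real.log_pos (by norm_num)
  refine ⟨4 * κ / Real.log 2 + 2, 112, by positivity, by norm_num, ?_⟩
  intro p k k' limit α β ε ε' hp hα hβ h hβκ hε0 hε hε'0 hε' hk hk' hlimit A τ _ _ _ _ a₀ U S w w'
    hU hS hw hw' hww
  have hk'1 : 1 ≤ k' := by
    have : (0 : ℝ) < k' := lt_of_lt_of_le (mul_pos (by positivity) (cutoff_pos hε'0 hε')) hk'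
    exact_mod_cast this
  -- the choice of `c` makes all binomial tails at most `ε ^ 2` and `ε' ^ 2`
  have hn : ∀ q ≤ p, ((2 ^ q : ℕ) : ℝ) * (4 * β ^ 2) ≤ 4 * κ := by
    intro q hq
    have h1 : (2 : ℝ) ^ q ≤ 2 ^ p := pow_le_pow_right₀ (by norm_num) hq
    push_cast
    nlinarith [mul_le_mul_of_nonneg_left h1 (sq_nonneg β)]
  have hn' : ∀ q ≤ p, ((2 ^ q : ℕ) : ℝ) * β ^ 2 ≤ 4 * κ := by
    intro q hq
    refine le_trans ?_ (hn q hq)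
    gcongr
    nlinarith [sq_nonneg β]
  have htail : ∀ q ≤ p, ∑ x : Bits (2 ^ q) with k ≤ wt x, (β ^ 2) ^ wt x ≤ ε ^ 2 :=
    fun q hq => sum_pow_wt_tail_le (sq_nonneg β) (hn' q hq) hε0 hε hk
  have htail' : ∑ x : Bits (2 ^ p) with k' ≤ wt x, (β ^ 2) ^ wt x ≤ ε' ^ 2 :=
    sum_pow_wt_tail_le (sq_nonneg β) (hn' p le_rfl) hε'0 hε' hk'
  have hout : ∑ x : Bits (2 ^ p) with k' ≤ wt x, (4 * β ^ 2) ^ wt x ≤ ε' ^ 2 :=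
    sum_pow_wt_tail_le (by positivity) (hn p le_rfl) hε'0 hε' hk'
  have hU1 : ∀ q ≤ p, (U q)ᴴ * U q = 1 := fun q hq => (hU q hq).conjTranspose_mul_self
  have hS1 : ∀ q < p, (S q)ᴴ * S q = 1 := fun q hq => (hS q hq).1
  have hm : 1 ≤ 2 ^ p := Nat.one_le_two_pow
  have hd : 2 * ε ^ 2 ≤ (Real.sqrt 2 * ε) ^ 2 := by
    rw [mul_pow, Real.sq_sqrt (by norm_num)]
  have hreg := isTree_register (a₀ := a₀) (k := k) h hm hU1 hS1
  have hclose := sum_nsq_contract_sub_le (isTree_bits h p) hreg (isTree_lowBits h p k)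
    (isApproxEmbedding_bits hα hβ h fun q hq => (htail q hq).trans (by nlinarith))
    (isApproxEmbedding_register hα hβ h hε le_rfl hU hS htail hd) (k' - 1)
    (uncState α β w) (regState a₀ (U p) w') (lowState α β k k' w) (nsq_lowState_le h hw)
    (sum_nsq_uncState_sub_le hα hβ h hw (htail p le_rfl) htail')
    (sum_nsq_regState_sub_le hα hβ h hε (hU p le_rfl) hw' hww (htail p le_rfl) htail')
  simp only [treeRow_bits h] at hclose
  have hG : (Finset.univ.filter fun b : Bits (2 ^ p) => wt b ≤ k' - 1)ᶜ =
      Finset.univ.filter fun b => k' ≤ wt b := by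
    ext b
    simp only [Finset.mem_compl, Finset.mem_filter, Finset.mem_univ, true_and]
    omega
  -- `D ^ 2` exceeds the `ℓ²` bound `4 (3 ε² + 2 ε'² + 20 ε² (1 + 2 p k')²)` of `hclose`
  set D : ℝ := 28 * (ε * k' * p) + 3 * ε' with hD
  have hk'r : (1 : ℝ) ≤ k' := by exact_mod_cast hk'1
  have hpr : (1 : ℝ) ≤ p := by exact_mod_cast hp
  have hD0 : 0 < D := by positivity
  have hmain := sum_traceNorm_sub_le (Finset.univ.filter fun b : Bits (2 ^ p) => wt b ≤ k' - 1)
    (fun b => contract (gateRPow α β (2 ^ p) b) (uncState α β w))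
    (fun b => contract (registerRow a₀ U S (regLeaf α β k (2 ^ p)) p b) (regState a₀ (U p) w'))
    (comOutcome a₀ U S limit w') hD0 ?_ ?_ ?_ ?_ ?_ ?_
  · rw [Dav]
    simp only [uncOutcome_eq]
    refine hmain.trans ?_
    rw [hG]
    have h1 : ∑ b : Bits (2 ^ p) with k' ≤ wt b,
        nsq (contract (gateRPow α β (2 ^ p) b) (uncState α β w)) ≤ ε' ^ 2 :=
      (Finset.sum_le_sum fun b _ => nsq_contract_uncState_le hα hβ h hw b).trans hout
    have h2 : Real.logb 2 ((2 : ℝ) ^ p) = p := by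
      rw [← Real.rpow_natCast, Real.logb_rpow (by norm_num) (by norm_num)]
    rw [h2]
    nlinarith
  · rw [← nsq_uncState h hw, nsq_prod]
    simp only [nsq, contract]
    rw [Finset.sum_comm]
    refine Finset.sum_congr rfl fun t _ => ?_
    exact nsq_mulVec_of_isometry (gateRPow_isometry h (2 ^ p)) _
  · exact (Finset.sum_le_sum_of_subset_of_nonneg (Finset.subset_univ _)
      fun _ _ _ => nsq_nonneg _).trans
        ((hreg.sum_nsq_contract_le _).trans (nsq_regState_le (hU1 p le_rfl) hw'))
  · exact fun b => posSemidef_measure p limit (posSemidef_comState _ _ _) b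
  · rw [← Complex.re_sum]
    simp only [comOutcome]
    rw [sum_trace_measure hU1 hS1 le_rfl, trace_comState a₀ (hU1 p le_rfl) hw', Complex.one_re]
  · intro b hb
    have hb : wt b ≤ k' - 1 := by simpa using hb
    exact posSemidef_comOutcome_sub hU1 (nsq_regLeaf_le h hm) w' (by omega)
  · refine hclose.trans ?_
    rw [Nat.cast_sub hk'1, Nat.cast_one, sub_add_cancel, mul_pow, Real.sq_sqrt (by norm_num)]
    have hpk : 1 ≤ (p : ℝ) * k' := one_le_mul_of_one_le_of_one_le hpr hk'r
    have h1 : (1 + 2 * (p : ℝ) * k') ^ 2 ≤ (3 * (p * k')) ^ 2 := by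
      gcongr
      linarith
    have h2 : ε ^ 2 ≤ ε ^ 2 * (p * k') ^ 2 :=
      le_mul_of_one_le_right (sq_nonneg ε) (one_le_pow₀ hpk)
    have h3 := mul_le_mul_of_nonneg_left h1 (sq_nonneg ε)
    have h4 : 0 ≤ ε * k' * p * ε' := by positivity
    rw [hD]
    nlinarith
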